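/- Let $\Lambda=(-1,1)$, $\mu\in(0,1)$, $\nu=2-\mu\in(1,2)$. For $\rho>0$ put $I_+^\rho v(x)=\frac1{\Gamma(\rho)}\int_x^1 (y-x)^{\rho-1}v(y)\,dy$, and for $s\in[k-1,k)$, $k\in\mathbb N$, put $D_+^s v=(-1)^kD^kI_+^{k-s}v$ (with $D^k$ the weak derivative on $\Lambda$). Let $\omega^{(a,b)}(x)=(1-x)^a(1+x)^b$, let $\|\cdot\|$ and $\|\cdot\|_{\omega^{(a,b)}}$ be the norms of $L^2(\Lambda)$ and $L^2_{\omega^{(a,b)}}(\Lambda)$, let $(\cdot,\cdot)$ be the $L^2(\Lambda)$ inner product and also the duality pairing of $H^{-1}(\Lambda)$ and $H^1_0(\Lambda)$, and let $\mathcal P_N$ be the real polynomials of degree at most $N$. For $f\in H^{-1}(\Lambda)$ consider the problem $D_+^\nu u=f$ in $\Lambda$, $I_+^\mu u(\pm1)=0$, in its weak form: $u\in L^1(\Lambda)$, $v:=I_+^\mu u\in H_0^1(\Lambda)$, and $$-(Dv,Dw)=(f,w)\qquad\forall\,w\in H^1_0(\Lambda).$$ For $N\ge1$ let $V_N=\{\phi=(1-x)^{1-\mu}\psi:\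 \psi\in\mathcal P_{N-1},\ I_+^\mu\phi(-1)=0\}$ and $\mathcal P_N^0=\mathcal P_N\cap H_0^1(\Lambda)$. The GJF-Petrov-Galerkin scheme is: find $u_N\in V_N$ such that $$(D_+^{1-\mu}u_N,Dw_N)=(f,w_N)\qquad\forall\,w_N\in\mathcal P_N^0 .$$ (a) For all $N\ge 1$ and $f\in H^{-1}(\Lambda)$ the scheme has a unique solution. The generalized Jacobi functions $J_n(x)=(1-x)^{1-\mu}P_n^{(1-\mu,\mu-1)}(x)$, $1\le n\le N-1$, form a basis of $V_N$, the functions $I_+^1P_j$, $1\le j\le N-1$ ($P_j$ the Legendre polynomials), form a basis of $\mathcal P_N^0$, and in these bases the scheme is a linear system with diagonal matrix: $$(D_+^{1-\mu}J_n,\,D I_+^1P_j)=-\frac{\Gamma(n+2-\mu)}{n!}\,\frac{2}{2n+1}\,\delta_{jn}.$$ (b) For every $m\in\mathbb N$, $m\ge1$, there is a constant $c>0$, independent of $N$, $f$ and $u$, such that for all $N\ge1$ with $m\le N+1$, all $f\in H^{-1}(\Lambda)$, every weak solution $u$ and the solution $u_N$ of the scheme: if $D_+^{m-\mu}u\in L^2_{\omega^{(m-1,m-1)}}(\Lambda)$,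 then $$\|D_+^{1-\mu}(u-u_N)\|\le c\,N^{1-m}\,\|D_+^{m-\mu}u\|_{\omega^{(m-1,m-1)}};$$ and if $m\ge2$ and the distributional derivative $f^{(m-2)}$ lies in $L^2_{\omega^{(m-1,m-1)}}(\Lambda)$, then $$\|D_+^{1-\mu}(u-u_N)\|\le c\,N^{1-m}\,\|f^{(m-2)}\|_{\omega^{(m-1,m-1)}}.$$ -/

import Mathlib

open MeasureTheory Set
open scoped ContDiff Distributions

noncomputable section

namespace GJF

/-- The interval `Λ = (-1, 1)`. -/
def Lam : TopologicalSpace.Opens ℝ := ⟨Ioo (-1) 1, isOpen_Ioo⟩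

/-- Lebesgue measure on `Λ`. -/
def lamMeasure : Measure ℝ := volume.restrict (Ioo (-1) 1)

/-- The Jacobi weight `ω^{(a,b)}(x) = (1-x)^a (1+x)^b`. -/
def jacobiWeight (a b x : ℝ) : ℝ := (1 - x) ^ a * (1 + x) ^ b

/-- The measure `ω^{(a,b)}(x) dx` on `Λ`; `Lp ℝ 2 (jacobiMeasure a b)` is `L²_{ω^{(a,b)}}(Λ)`. -/
def jacobiMeasure (a b : ℝ) : Measure ℝ :=
  lamMeasure.withDensity fun x => ENNReal.ofReal (jacobiWeight a b x)

/-- The Hilbert space `L²(Λ)`. -/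
abbrev L2 : Type := Lp ℝ 2 lamMeasure

/-- `g` is the `k`-th weak derivative of `v` on `Λ`. -/
def HasWeakDeriv (k : ℕ) (v g : ℝ → ℝ) : Prop :=
  LocallyIntegrableOn v (Ioo (-1) 1) ∧ LocallyIntegrableOn g (Ioo (-1) 1) ∧
    ∀ φ : 𝓓(Lam, ℝ),
      ∫ x, v x * iteratedDeriv k φ x ∂lamMeasure = (-1) ^ k * ∫ x, g x * φ x ∂lamMeasure

/-- The right fractional integral `I_+^ρ v(x) = Γ(ρ)⁻¹ ∫_x^1 v(y) (y-x)^{ρ-1} dy`. -/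
def fracInt (ρ : ℝ) (v : ℝ → ℝ) (x : ℝ) : ℝ :=
  (Real.Gamma ρ)⁻¹ * ∫ y in x..1, v y / (y - x) ^ (1 - ρ)

/-- `g` is the right Riemann-Liouville derivative `D_+^s v = (-1)^k D^k I_+^{k-s} v` on `Λ`, where
`s ∈ [k-1, k)`, that is `k = ⌊s⌋ + 1`; the outer derivative `D^k` is a weak one. -/
def HasFracDeriv (s : ℝ) (v g : ℝ → ℝ) : Prop :=
  IntegrableOn v (Ioo (-1) 1) ∧
    HasWeakDeriv (⌊s⌋₊ + 1) (fracInt ((⌊s⌋₊ + 1 : ℕ) - s) v) fun x => (-1) ^ (⌊s⌋₊ + 1) * g x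

lemma integrable_mul_of_test {v φ : ℝ → ℝ} (hv : LocallyIntegrableOn v (Ioo (-1) 1))
    (hc : Continuous φ) (hs : HasCompactSupport φ) (hsub : tsupport φ ⊆ Ioo (-1) 1) :
    Integrable (fun x => v x * φ x) lamMeasure := by
  have h1 : IntegrableOn v (tsupport φ) := hv.integrableOn_compact_subset hsub hs
  have h2 : IntegrableOn (fun x => v x * φ x) (tsupport φ) :=
    h1.mul_continuousOn hc.continuousOn hs
  have h3 : Integrable (fun x => v x * φ x) := by
    rwa [integrableOn_iff_integrable_of_support_subset] at h2
    intro x hx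
    apply subset_tsupport
    intro h
    exact hx (by simp [h])
  exact h3.integrableOn

lemma integrable_mul_test {v : ℝ → ℝ} (hv : LocallyIntegrableOn v (Ioo (-1) 1))
    (φ : 𝓓(Lam, ℝ)) (k : ℕ) :
    Integrable (fun x => v x * iteratedDeriv k φ x) lamMeasure := by
  have hsup : tsupport (iteratedDeriv k φ) ⊆ tsupport φ := by
    refine closure_minimal ?_ (isClosed_tsupport _)
    have := support_iteratedFDeriv_subset (𝕜 := ℝ) (f := φ) k
    intro x hx
    apply this
    intro h0
    apply hx
    simp [iteratedDeriv_eq_iteratedFDeriv, h0]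
  refine integrable_mul_of_test hv ?_ ?_ (hsup.trans φ.tsupport_subset)
  · exact φ.contDiff.continuous_iteratedDeriv k (by exact_mod_cast le_top)
  · exact φ.hasCompactSupport.of_isClosed_subset (isClosed_tsupport _) hsup

lemma HasWeakDeriv.congr {k : ℕ} {v g v' g' : ℝ → ℝ} (h : HasWeakDeriv k v g)
    (hv : v' =ᵐ[lamMeasure] v) (hg : g' =ᵐ[lamMeasure] g) : HasWeakDeriv k v' g' := by
  have key : ∀ {a b : ℝ → ℝ}, LocallyIntegrableOn a (Ioo (-1) 1) → b =ᵐ[lamMeasure] a →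
      LocallyIntegrableOn b (Ioo (-1) 1) := by
    intro a b ha hab
    rw [locallyIntegrableOn_iff isOpen_Ioo.isLocallyClosed] at ha ⊢
    intro K hK hKc
    exact (ha K hK hKc).congr (ae_restrict_of_ae_restrict_of_subset hK hab.symm)
  refine ⟨key h.1 hv, key h.2.1 hg, fun φ => ?_⟩
  rw [integral_congr_ae (g := fun x => v x * iteratedDeriv k φ x)
      (by filter_upwards [hv] with x hx; rw [hx]),
    integral_congr_ae (f := fun x => g' x * φ x) (g := fun x => g x * φ x)
      (by filter_upwards [hg] with x hx; rw [hx])]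
  exact h.2.2 φ

lemma HasWeakDeriv.zero (k : ℕ) : HasWeakDeriv k (fun _ => 0) (fun _ => 0) :=
  ⟨locallyIntegrableOn_zero, locallyIntegrableOn_zero, fun φ => by simp⟩

lemma HasWeakDeriv.add {k : ℕ} {v g v' g' : ℝ → ℝ} (h : HasWeakDeriv k v g)
    (h' : HasWeakDeriv k v' g') :
    HasWeakDeriv k (fun x => v x + v' x) (fun x => g x + g' x) := by
  refine ⟨h.1.add h'.1, h.2.1.add h'.2.1, fun φ => ?_⟩
  have e1 := integral_add (integrable_mul_test h.1 φ k) (integrable_mul_test h'.1 φ k)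
  have e2 := integral_add (integrable_mul_test h.2.1 φ 0) (integrable_mul_test h'.2.1 φ 0)
  simp only [iteratedDeriv_zero] at e2
  simp only [add_mul]
  rw [e1, e2, h.2.2 φ, h'.2.2 φ, mul_add]

lemma HasWeakDeriv.smul {k : ℕ} {v g : ℝ → ℝ} (h : HasWeakDeriv k v g) (c : ℝ) :
    HasWeakDeriv k (fun x => c * v x) (fun x => c * g x) := by
  refine ⟨h.1.smul c, h.2.1.smul c, fun φ => ?_⟩
  simp only [mul_assoc, integral_const_mul, h.2.2 φ]
  ring

/-- `H¹(Λ)`: the pairs `(v, v')` with `v, v' ∈ L²(Λ)` and `v'` the weak derivative of `v`, with the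
norm `‖v‖² + ‖v'‖²`. For `v : H1`, `v.1.fst` is the function and `v.1.snd` its derivative. -/
def H1 : Submodule ℝ (WithLp 2 (L2 × L2)) where
  carrier := {p | HasWeakDeriv 1 p.fst p.snd}
  zero_mem' := (HasWeakDeriv.zero 1).congr (Lp.coeFn_zero ℝ 2 lamMeasure)
    (Lp.coeFn_zero ℝ 2 lamMeasure)
  add_mem' := fun {p q} hp hq => (HasWeakDeriv.add hp hq).congr
    (Lp.coeFn_add p.fst q.fst) (Lp.coeFn_add p.snd q.snd)
  smul_mem' := fun c p hp => (HasWeakDeriv.smul hp c).congr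
    (Lp.coeFn_smul c p.fst) (Lp.coeFn_smul c p.snd)

/-- `H¹₀(Λ)`: the elements of `H¹(Λ)` whose continuous representative vanishes at `-1` and `1`. -/
def H10 : Submodule ℝ (WithLp 2 (L2 × L2)) where
  carrier := {p | p ∈ H1 ∧ ∃ c : ℝ → ℝ, ContinuousOn c (Icc (-1) 1) ∧ c (-1) = 0 ∧ c 1 = 0 ∧
    p.fst =ᵐ[lamMeasure] c}
  zero_mem' := ⟨H1.zero_mem, fun _ => 0, continuousOn_const, rfl, rfl,
    Lp.coeFn_zero ℝ 2 lamMeasure⟩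
  add_mem' := by
    rintro p q ⟨hp, c, hc, h1, h2, h3⟩ ⟨hq, c', hc', h1', h2', h3'⟩
    refine ⟨H1.add_mem hp hq, fun x => c x + c' x, hc.add hc', by simp [h1, h1'],
      by simp [h2, h2'], ?_⟩
    filter_upwards [Lp.coeFn_add p.fst q.fst, h3, h3'] with x e0 e1 e2
    rw [WithLp.add_fst, e0, Pi.add_apply, e1, e2]
  smul_mem' := by
    rintro a p ⟨hp, c, hc, h1, h2, h3⟩
    refine ⟨H1.smul_mem a hp, fun x => a * c x, hc.const_mul a, by simp [h1], by simp [h2], ?_⟩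
    filter_upwards [Lp.coeFn_smul a p.fst, h3] with x e0 e1
    rw [WithLp.smul_fst, e0, Pi.smul_apply, e1, smul_eq_mul]

/-- `H⁻¹(Λ)`, the dual space of `H¹₀(Λ)`; `f w` is the pairing `(f, w)`. -/
abbrev HNeg : Type := StrongDual ℝ H10

/-- `g` is the `k`-th distributional derivative `f^{(k)}` of `f ∈ H⁻¹(Λ)` on `Λ`:
`(f, φ^{(k)}) = (-1)^k ∫ g φ` for all test functions `φ`, where `w` is `φ^{(k)}` as an element
of `H¹₀(Λ)` (there is exactly one such `w`). -/
def HasDistribDeriv (k : ℕ) (f : HNeg) (g : ℝ → ℝ) : Prop :=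
  LocallyIntegrableOn g (Ioo (-1) 1) ∧
    ∀ φ : 𝓓(Lam, ℝ), ∃ w : H10, w.1.fst =ᵐ[lamMeasure] iteratedDeriv k φ ∧
      f w = (-1) ^ k * ∫ x, g x * φ x ∂lamMeasure

/-- `u` is the solution of `D_+^ν u = f`, `I_+^μ u(±1) = 0`, where `ν = 2 - μ`, in the weak sense:
`v = I_+^μ u` is in `H¹₀(Λ)` and `-(Dv, Dw) = (f, w)` for all `w ∈ H¹₀(Λ)`. -/
def IsWeakSolution (μ : ℝ) (f : HNeg) (u : ℝ → ℝ) : Prop :=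
  IntegrableOn u (Ioo (-1) 1) ∧
    ∃ v : H10, v.1.fst =ᵐ[lamMeasure] fracInt μ u ∧
      ∀ w : H10, -inner ℝ v.1.snd w.1.snd = f w

/-- The Jacobi polynomial `P_n^{(α,β)}` with arbitrary real parameters,
`∑_j (n+α+β+1)_j (α+j+1)_{n-j} / (j! (n-j)!) ((x-1)/2)^j`. -/
def jacobiP (α β : ℝ) (n : ℕ) : Polynomial ℝ :=
  ∑ j ∈ Finset.range (n + 1),
    Polynomial.C ((ascPochhammer ℝ j).eval (n + α + β + 1) *
      (ascPochhammer ℝ (n - j)).eval (α + j + 1) / (j.factorial * (n - j).factorial)) *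
    (Polynomial.C (1 / 2) * (Polynomial.X - 1)) ^ j

/-- The generalized Jacobi function `⁺J_n^{(-α,β)}(x) = (1-x)^α P_n^{(α,β)}(x)`. -/
def gjf (α β : ℝ) (n : ℕ) (x : ℝ) : ℝ := (1 - x) ^ α * (jacobiP α β n).eval x

lemma fracInt_integrable {μ : ℝ} (hμ0 : 0 < μ) (hμ1 : μ < 1) (ψ : Polynomial ℝ) :
    IntervalIntegrable (fun y : ℝ => (1 - y) ^ (1 - μ) * ψ.eval y / (y - -1) ^ (1 - μ))
      volume (-1) 1 := by
  have h1 : IntervalIntegrable (fun y : ℝ => (y - -1) ^ (μ - 1)) volume (-1) 1 := by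
    have := (intervalIntegral.intervalIntegrable_rpow' (a := 0) (b := 2) (r := μ - 1)
      (by linarith)).comp_sub_right (-1)
    convert this using 1 <;> norm_num
  have h2 : ContinuousOn (fun y : ℝ => (1 - y) ^ (1 - μ) * ψ.eval y) (uIcc (-1) 1) := by
    apply Continuous.continuousOn
    exact ((continuous_const.sub continuous_id).rpow_const
      (fun _ => Or.inr (by linarith))).mul ψ.continuous
  refine (h1.continuousOn_mul h2).congr ?_
  intro y hy
  rw [uIoc_of_le (by norm_num)] at hy
  have hy0 : 0 ≤ y - -1 := by linarith [hy.1]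
  simp only
  rw [div_eq_mul_inv, ← Real.rpow_neg hy0]
  congr 2
  ring

/-- The trial space `V_N = {φ = (1-x)^{1-μ} ψ : ψ ∈ 𝒫_{N-1}, I_+^μ φ(-1) = 0}`, where
`degreeLT ℝ N` is the space of polynomials of degree at most `N - 1`. -/
def VN (μ : ℝ) (hμ0 : 0 < μ) (hμ1 : μ < 1) (N : ℕ) : Submodule ℝ (ℝ → ℝ) where
  carrier := {φ | (∃ ψ ∈ Polynomial.degreeLT ℝ N, φ = fun x => (1 - x) ^ (1 - μ) * ψ.eval x) ∧
    fracInt μ φ (-1) = 0}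
  zero_mem' := ⟨⟨0, Submodule.zero_mem _, by ext; simp⟩, by simp [fracInt]⟩
  add_mem' := by
    rintro _ _ ⟨⟨ψ, hψ, rfl⟩, h⟩ ⟨⟨χ, hχ, rfl⟩, h'⟩
    refine ⟨⟨ψ + χ, Submodule.add_mem _ hψ hχ, by ext; simp [mul_add]⟩, ?_⟩
    have e := intervalIntegral.integral_add (fracInt_integrable hμ0 hμ1 ψ)
      (fracInt_integrable hμ0 hμ1 χ)
    simp only [fracInt] at h h' ⊢
    simp only [Pi.add_apply, add_div]
    rw [e, mul_add, h, h', add_zero]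
  smul_mem' := by
    rintro c _ ⟨⟨ψ, hψ, rfl⟩, h⟩
    refine ⟨⟨c • ψ, Submodule.smul_mem _ c hψ, by ext; simp; ring⟩, ?_⟩
    simp only [fracInt] at h ⊢
    simp only [Pi.smul_apply, smul_eq_mul, mul_div_assoc, intervalIntegral.integral_const_mul]
    simp only [mul_div_assoc] at h
    rw [mul_left_comm, h, mul_zero]

/-- The test space `𝒫_N^0 = 𝒫_N ∩ H¹₀(Λ)`. -/
def PN0 (N : ℕ) : Submodule ℝ H10 where
  carrier := {w | ∃ p ∈ Polynomial.degreeLE ℝ N, w.1.fst =ᵐ[lamMeasure] fun x => p.eval x}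
  zero_mem' := ⟨0, Submodule.zero_mem _, by
    filter_upwards [Lp.coeFn_zero ℝ 2 lamMeasure] with x hx
    simpa using hx⟩
  add_mem' := by
    rintro v w ⟨p, hp, h⟩ ⟨q, hq, h'⟩
    refine ⟨p + q, Submodule.add_mem _ hp hq, ?_⟩
    filter_upwards [Lp.coeFn_add v.1.fst w.1.fst, h, h'] with x e0 e1 e2
    rw [Submodule.coe_add, WithLp.add_fst, e0, Pi.add_apply, e1, e2, Polynomial.eval_add]
  smul_mem' := by
    rintro c v ⟨p, hp, h⟩
    refine ⟨c • p, Submodule.smul_mem _ c hp, ?_⟩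
    filter_upwards [Lp.coeFn_smul c v.1.fst, h] with x e0 e1
    rw [Submodule.coe_smul, WithLp.smul_fst, e0, Pi.smul_apply, e1, Polynomial.eval_smul]

/-- `uN` solves the GJF-Petrov-Galerkin scheme: `uN ∈ V_N` and `(D_+^{1-μ} uN, Dw) = (f, w)` for all
`w ∈ 𝒫_N^0`; here `d = D_+^{1-μ} uN`. -/
def IsGJFSolution (μ : ℝ) (hμ0 : 0 < μ) (hμ1 : μ < 1) (N : ℕ) (f : HNeg) (uN : ℝ → ℝ) : Prop :=
  uN ∈ VN μ hμ0 hμ1 N ∧ ∃ d : L2, HasFracDeriv (1 - μ) uN d ∧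
    ∀ w ∈ PN0 N, inner ℝ d w.1.snd = f w

end GJF

end

open GJF

/-! The operator `I_+^μ` turns generalized Jacobi functions into integrated Legendre polynomials.
The Beta integral gives the image of each power (1-x)^{1-μ+j}, and since the two Jacobi parameters
add up to 0, the coefficients of `J_n` become those of `P_n` up to one common factor: `I_+^μ J_n =
Γ(n+2-μ)/n! ∫_x^1 P_n` (`fracInt_gjf`). Hence `D_+^{1-μ} J_n` is a positive multiple of `P_n`, while
the test functions `I_+^1 P_j` have derivative `-P_j`. Legendre orthogonality makes the matrix
diagonal with nonzero entries, which gives unique solvability.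

For the error, put v = `I_+^μ u`, so that `D_+^{1-μ} u` = -Dv. Comparing the weak form with the
scheme shows that e = `D_+^{1-μ}(u - u_N)` is orthogonal to P_1, ..., P_{N-1}. It is also orthogonal
to P_0, because Dv has mean zero (`integral_weakDeriv_eq_zero`) and `D_+^{1-μ} u_N` has no P_0
component. As the latter has degree below N, e is the error of the L² projection of h = -Dv
(`exists_error`).

It remains to bound that error by g, which up to sign is the weak derivative of h of order k = m-1.
By the Legendre equation the k-th derivative of (1-x²)^k P_n^{(k)} is (-1)^k λ P_n with λ = λ_{n,k}
= (n+k)!/(n-k)!. The definition of the weak derivative extends from test functions to such weighted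
polynomials (`integral_weak_weight`), so (h, P_n) is ± λ⁻¹ times the weighted product of g and
P_n^{(k)}. These derivatives are orthogonal for the weight (1-x²)^k, with squared norm λ‖P_n‖².
Testing e against a polynomial p therefore gives ± the weighted product of g with a polynomial of
norm at most ‖p‖ max_{n≥N} λ_{n,k}^{-1/2}, and λ_{n,k} ≥ N^{2k}/k^k for n ≥ N (`pow_le_legLam`).
Polynomials are dense in L², so this bounds ‖e‖ (`norm_projection_error_le`). -/

noncomputable section

namespace GJF

open Polynomial Filter Topology

/-! ### Jacobi and Legendre polynomials -/

/-- The `j`-th coefficient of `P_n^{(α,β)}` as a polynomial in `(x-1)/2`. -/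
def jacobiCoeff (α β : ℝ) (n j : ℕ) : ℝ :=
  (ascPochhammer ℝ j).eval (n + α + β + 1) *
      (ascPochhammer ℝ (n - j)).eval (α + j + 1) / (j.factorial * (n - j).factorial)

/-- The polynomial `P_n^{(α,β)}(1 + 2s)` in the variable `s`. -/
def jacobiShift (α β : ℝ) (n : ℕ) : ℝ[X] :=
  ∑ j ∈ Finset.range (n + 1), C (jacobiCoeff α β n j) * X ^ j

lemma jacobiP_eq_comp (α β : ℝ) (n : ℕ) :
    jacobiP α β n = (jacobiShift α β n).comp (C (1 / 2) * (X - 1)) := by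
  simp only [jacobiP, jacobiShift, Polynomial.sum_comp, mul_comp, C_comp, pow_comp, X_comp,
    jacobiCoeff]

lemma coeff_jacobiShift (α β : ℝ) (n j : ℕ) :
    (jacobiShift α β n).coeff j = if j ≤ n then jacobiCoeff α β n j else 0 := by
  simp [jacobiShift]

lemma natDegree_half_mul_sub : (C (1 / 2 : ℝ) * (X - 1)).natDegree = 1 := by
  rw [natDegree_C_mul (by norm_num), ← C_1, natDegree_X_sub_C]

lemma degree_jacobiP {α β : ℝ} {n : ℕ} (h : 0 < n + α + β + 1) :
    (jacobiP α β n).degree = n := by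
  have hc : (jacobiShift α β n).coeff n ≠ 0 := by
    have := ascPochhammer_pos n _ h
    have h2 : (n.factorial : ℝ) ≠ 0 := by exact_mod_cast n.factorial_ne_zero
    simp [coeff_jacobiShift, jacobiCoeff, this.ne', h2]
  have hd : (jacobiShift α β n).natDegree = n := by
    refine natDegree_eq_of_le_of_coeff_ne_zero ?_ hc
    rw [natDegree_le_iff_coeff_eq_zero]
    intro j hj
    rw [coeff_jacobiShift, if_neg (by omega)]
  have h0 : (jacobiP α β n).natDegree = n := by
    rw [jacobiP_eq_comp, natDegree_comp, natDegree_half_mul_sub, hd, mul_one]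
  rcases Nat.eq_zero_or_pos n with hn | hn
  · subst hn
    rw [degree_eq_natDegree, h0]
    intro h1
    have h2 : jacobiP α β 0 = 1 := by simp [jacobiP]
    rw [h2] at h1
    exact one_ne_zero h1
  · rw [degree_eq_iff_natDegree_eq_of_pos hn, h0]

/-- The Legendre polynomial `P_n`. -/
abbrev leg (n : ℕ) : ℝ[X] := jacobiP 0 0 n

lemma degree_leg (n : ℕ) : (leg n).degree = n := degree_jacobiP (by positivity)

lemma ascPochhammer_eval_natCast_succ (a j : ℕ) :
    (ascPochhammer ℝ j).eval ((a : ℝ) + 1) = ((a + j).factorial : ℝ) / a.factorial := by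
  have h := Nat.factorial_mul_ascFactorial a j
  have h0 : (a.factorial : ℝ) ≠ 0 := by exact_mod_cast a.factorial_ne_zero
  have h2 : (ascPochhammer ℝ j).eval ((a : ℝ) + 1) = ((a + 1).ascFactorial j : ℕ) := by
    rw [← ascPochhammer_nat_eq_ascFactorial]
    have := ascPochhammer_eval_cast (S := ℝ) j (a + 1)
    rw [this, Nat.cast_add, Nat.cast_one]
  rw [h2, eq_div_iff h0, ← h]
  push_cast
  ring

/-! ### The Legendre equation, its derivatives, and orthogonality. -/

lemma coeff_legShift (n j : ℕ) :
    (jacobiShift 0 0 n).coeff j = ((n + j).choose j : ℝ) * n.choose j := by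
  rw [coeff_jacobiShift]
  split_ifs with h
  · have e1 := ascPochhammer_eval_natCast_succ n j
    have e2 := ascPochhammer_eval_natCast_succ j (n - j)
    rw [Nat.add_sub_cancel' h] at e2
    rw [jacobiCoeff, add_zero, add_zero, zero_add, e1, e2, Nat.cast_choose ℝ h,
      Nat.cast_choose ℝ (Nat.le_add_left j n), Nat.add_sub_cancel]
    have h1 : (n.factorial : ℝ) ≠ 0 := by exact_mod_cast n.factorial_ne_zero
    have h2 : (j.factorial : ℝ) ≠ 0 := by exact_mod_cast j.factorial_ne_zero
    have h3 : ((n - j).factorial : ℝ) ≠ 0 := by exact_mod_cast (n - j).factorial_ne_zero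
    field_simp
  · rw [Nat.choose_eq_zero_of_lt (by omega : n < j)]
    simp

/-- The coefficient recurrence behind the Legendre equation. Both sides vanish for j ≥ n, so no
bound on j is needed when coefficients are compared in `legShift_ode`. -/
lemma coeff_legShift_succ (n j : ℕ) :
    ((j : ℝ) + 1) ^ 2 * (jacobiShift 0 0 n).coeff (j + 1) =
      ((n : ℝ) - j) * (n + j + 1) * (jacobiShift 0 0 n).coeff j := by
  rw [coeff_legShift, coeff_legShift]
  have h1 : ((n + j + 1 : ℕ) : ℝ) * ((n + j).choose j : ℕ) =
      ((n + j + 1).choose (j + 1) : ℕ) * ((j + 1 : ℕ) : ℝ) := by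
    exact_mod_cast Nat.add_one_mul_choose_eq (n + j) j
  have h2 : (n.choose (j + 1) : ℝ) * (j + 1) = n.choose j * ((n : ℝ) - j) := by
    rcases le_or_gt j n with h | h
    · have := Nat.choose_succ_right_eq n j
      rw [← Nat.cast_sub h]
      exact_mod_cast this
    · rw [Nat.choose_eq_zero_of_lt h, Nat.choose_eq_zero_of_lt (by omega)]
      simp
  push_cast at h1
  rw [show n + (j + 1) = n + j + 1 by ring]
  linear_combination (-(n.choose (j+1) : ℝ) * (j + 1)) * h1 +
    ((n : ℝ) + j + 1) * ((n + j).choose j) * h2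

lemma legShift_ode (n : ℕ) :
    X * (1 + X) * derivative (derivative (jacobiShift 0 0 n)) +
      (1 + C 2 * X) * derivative (jacobiShift 0 0 n) =
      C ((n : ℝ) * (n + 1)) * jacobiShift 0 0 n := by
  set Y := jacobiShift 0 0 n with hY
  have e : X * (1 + X) * derivative (derivative Y) + (1 + C 2 * X) * derivative Y =
      X * derivative (derivative Y) + X * (X * derivative (derivative Y)) + derivative Y +
        C 2 * (X * derivative Y) := by ring
  rw [e]
  ext j
  rw [coeff_C_mul]
  have h := coeff_legShift_succ n j
  rw [← hY] at h
  rcases j with _ | _ | j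
  · simp [coeff_derivative] at h ⊢
    linarith
  · simp [coeff_derivative] at h ⊢
    linarith
  · simp [coeff_derivative] at h ⊢
    linarith

lemma leg_ode (n : ℕ) :
    (1 - X ^ 2) * derivative (derivative (leg n)) - C 2 * X * derivative (leg n) =
      -C ((n : ℝ) * (n + 1)) * leg n := by
  have h := congrArg (fun p => p.comp (C (1 / 2 : ℝ) * (X - 1))) (legShift_ode n)
  simp only [add_comp, mul_comp, X_comp, one_comp, C_comp] at h
  have hd : derivative (C (1 / 2 : ℝ) * (X - 1)) = C (1 / 2) := by simp
  have h1 : derivative (leg n) = C (1 / 2) * (derivative (jacobiShift 0 0 n)).comp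
      (C (1 / 2 : ℝ) * (X - 1)) := by
    rw [leg, jacobiP_eq_comp, derivative_comp, hd]
  have h2 : derivative (derivative (leg n)) = C (1 / 2) * (C (1 / 2) *
      (derivative (derivative (jacobiShift 0 0 n))).comp (C (1 / 2 : ℝ) * (X - 1))) := by
    rw [h1, derivative_C_mul, derivative_comp, hd]
  rw [h2, h1, leg, jacobiP_eq_comp]
  have hC : C (1 / 2 : ℝ) * C 2 = 1 := by rw [← C_mul]; norm_num
  have hC2 : (C (2 : ℝ)) = 2 := rfl
  generalize (derivative (derivative (jacobiShift 0 0 n))).comp (C (1 / 2 : ℝ) * (X - 1)) = A at *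
  generalize (derivative (jacobiShift 0 0 n)).comp (C (1 / 2 : ℝ) * (X - 1)) = B at *
  linear_combination -h - (A * C (1 / 2) * (X - 1) + B) * hC + C (1 / 2) ^ 2 * A * (X - 1) * hC2

lemma leg_ode_iterate (n k : ℕ) :
    (1 - X ^ 2) * derivative^[k + 2] (leg n) - C (2 * (k + 1 : ℝ)) * X * derivative^[k + 1] (leg n)
      = -C (((n : ℝ) - k) * (n + k + 1)) * derivative^[k] (leg n) := by
  induction k with
  | zero =>
    have := leg_ode n
    simpa using this
  | succ k ih =>
    have h := congrArg derivative ih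
    simp only [derivative_sub, derivative_mul, derivative_one, derivative_X_pow, derivative_C,
      derivative_X, derivative_neg, ← Function.iterate_succ_apply' derivative] at h
    simp only [Nat.succ_eq_add_one, C_mul, C_add, C_sub, C_1, C_ofNat, Nat.cast_add, Nat.cast_one,
      Nat.cast_ofNat] at h ⊢
    linear_combination h

/-- The product `λ_{n,k} = ∏_{i<k} (n-i)(n+i+1) = (n+k)!/(n-k)!`. -/
def legLam (n k : ℕ) : ℝ := ∏ i ∈ Finset.range k, ((n : ℝ) - i) * (n + i + 1)

/-- The self-adjoint form of the k times differentiated Legendre equation: multiplying by (1-x²)^k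
turns the two left-hand terms into one derivative. -/
lemma derivative_weight_mul (n k : ℕ) :
    derivative ((1 - X ^ 2) ^ (k + 1) * derivative^[k + 1] (leg n)) =
      -C (((n : ℝ) - k) * (n + k + 1)) * ((1 - X ^ 2) ^ k * derivative^[k] (leg n)) := by
  have h := leg_ode_iterate n k
  rw [derivative_mul, ← Function.iterate_succ_apply' derivative, derivative_pow_succ]
  simp only [derivative_sub, derivative_one, derivative_X_pow, Nat.succ_eq_add_one]
  simp only [C_mul, C_add, C_sub, C_1, C_ofNat, Nat.cast_ofNat, map_natCast] at h ⊢
  linear_combination (1 - X ^ 2) ^ k * h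

lemma iterate_derivative_weight_mul (n k : ℕ) :
    derivative^[k] ((1 - X ^ 2) ^ k * derivative^[k] (leg n)) =
      C ((-1) ^ k * legLam n k) * leg n := by
  induction k with
  | zero => simp [legLam]
  | succ k ih =>
    rw [Function.iterate_succ_apply, derivative_weight_mul, neg_mul, iterate_derivative_neg,
      iterate_derivative_C_mul, ih, legLam, legLam, Finset.prod_range_succ]
    simp only [C_mul, pow_succ, map_neg, C_1]
    ring

lemma integral_derivative (p : ℝ[X]) :
    ∫ x in (-1 : ℝ)..1, (derivative p).eval x = p.eval 1 - p.eval (-1) :=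
  intervalIntegral.integral_eq_sub_of_hasDerivAt (fun x _ => p.hasDerivAt x)
    ((derivative p).continuous.intervalIntegrable _ _)

/-- One integration by parts per step of the induction. The factor (1-x²)^{k+1} removes the boundary
terms, and `derivative_weight_mul` supplies the next factor of `legLam`. With k = n this yields
orthogonality and the Legendre norms; with general k, the weighted products of derivatives. -/
lemma integral_weight_mul_derivative (n k : ℕ) (q : ℝ[X]) :
    ∫ x in (-1 : ℝ)..1,
      ((1 - X ^ 2) ^ k * derivative^[k] (leg n) * derivative^[k] q).eval x =
      legLam n k * ∫ x in (-1 : ℝ)..1, (leg n * q).eval x := by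
  induction k with
  | zero => simp [legLam]
  | succ k ih =>
    have h := integral_derivative
      ((1 - X ^ 2) ^ (k + 1) * derivative^[k + 1] (leg n) * derivative^[k] q)
    rw [derivative_mul, derivative_weight_mul, ← Function.iterate_succ_apply' derivative k q] at h
    have e : ∀ x : ℝ, (-C (((n : ℝ) - k) * (n + k + 1)) *
        ((1 - X ^ 2) ^ k * derivative^[k] (leg n)) * derivative^[k] q +
        (1 - X ^ 2) ^ (k + 1) * derivative^[k + 1] (leg n) * derivative^[k + 1] q).eval x =
        -(((n : ℝ) - k) * (n + k + 1)) *
          ((1 - X ^ 2) ^ k * derivative^[k] (leg n) * derivative^[k] q).eval x +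
        ((1 - X ^ 2) ^ (k + 1) * derivative^[k + 1] (leg n) * derivative^[k + 1] q).eval x := by
      intro x
      simp only [eval_add, eval_mul, eval_neg, eval_C]
      ring
    simp only [Nat.succ_eq_add_one] at h
    simp only [e] at h
    rw [intervalIntegral.integral_add, intervalIntegral.integral_const_mul, ih] at h
    · rw [legLam, Finset.prod_range_succ, ← legLam]
      have e1 : (((1 - X ^ 2) ^ (k + 1) * derivative^[k + 1] (leg n) *
        derivative^[k] q) : ℝ[X]).eval 1 = 0 := by simp
      have e2 : (((1 - X ^ 2) ^ (k + 1) * derivative^[k + 1] (leg n) *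
        derivative^[k] q) : ℝ[X]).eval (-1) = 0 := by simp
      rw [e1, e2] at h
      linear_combination h
    · exact (Continuous.intervalIntegrable (by fun_prop) _ _)
    · exact (Continuous.intervalIntegrable (by fun_prop) _ _)

lemma legLam_mul_factorial {n k : ℕ} (h : k ≤ n) :
    legLam n k * (n - k).factorial = (n + k).factorial := by
  induction k with
  | zero => simp [legLam]
  | succ k ih =>
    have e : n - k = (n - (k + 1)) + 1 := by omega
    have ih' := ih (by omega)
    have hc : ((n - (k + 1) : ℕ) : ℝ) = n - (k + 1) := by
      rw [Nat.cast_sub h]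
      push_cast
      ring
    rw [e, Nat.factorial_succ, Nat.cast_mul, Nat.cast_add, hc] at ih'
    rw [legLam, Finset.prod_range_succ, ← legLam, ← add_assoc, Nat.factorial_succ, Nat.cast_mul,
      ← ih']
    push_cast
    ring

lemma legLam_pos {n k : ℕ} (h : k ≤ n) : 0 < legLam n k := by
  have h1 : (0 : ℝ) < (n - k).factorial := by exact_mod_cast (n - k).factorial_pos
  have h2 : (0 : ℝ) < (n + k).factorial := by exact_mod_cast (n + k).factorial_pos
  rw [← legLam_mul_factorial h] at h2
  exact (pos_iff_pos_of_mul_pos h2).2 h1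

/-- Legendre polynomials are orthogonal to all polynomials of lower degree. -/
lemma integral_leg_mul_of_degree_lt {n : ℕ} {q : ℝ[X]} (h : q.degree < n) :
    ∫ x in (-1 : ℝ)..1, (leg n * q).eval x = 0 := by
  have h1 := integral_weight_mul_derivative n n q
  have h2 : derivative^[n] q = 0 := by
    rcases eq_or_ne q 0 with rfl | hq
    · simp
    · exact iterate_derivative_eq_zero ((natDegree_lt_iff_degree_lt hq).2 h)
  rw [h2] at h1
  simp only [mul_zero, eval_zero, intervalIntegral.integral_zero] at h1
  exact (mul_eq_zero.1 h1.symm).resolve_left (legLam_pos le_rfl).ne'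

lemma integral_leg_mul_leg_of_ne {n j : ℕ} (h : n ≠ j) :
    ∫ x in (-1 : ℝ)..1, (leg n * leg j).eval x = 0 := by
  rcases lt_or_gt_of_ne h with h | h
  · rw [mul_comm]
    exact integral_leg_mul_of_degree_lt (by rw [degree_leg]; exact_mod_cast h)
  · exact integral_leg_mul_of_degree_lt (by rw [degree_leg]; exact_mod_cast h)

lemma integral_weight_pow (n : ℕ) :
    (∫ x in (-1 : ℝ)..1, (1 - x ^ 2) ^ n) * (2 * n + 1).factorial =
      2 ^ (2 * n + 1) * (n.factorial : ℝ) ^ 2 := by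
  induction n with
  | zero => norm_num
  | succ n ih =>
    -- This polynomial vanishes at ±1, which yields the recurrence (2n+3) I_{n+1} = (2n+2) I_n for
    -- the integrals.
    have h := integral_derivative (X * (1 - X ^ 2) ^ (n + 1))
    have e : ∀ x : ℝ, (derivative (X * (1 - X ^ 2) ^ (n + 1) : ℝ[X])).eval x =
        (2 * n + 3) * (1 - x ^ 2) ^ (n + 1) - (2 * n + 2) * (1 - x ^ 2) ^ n := by
      intro x
      rw [derivative_mul, derivative_pow_succ]
      simp
      ring
    simp only [e] at h
    rw [intervalIntegral.integral_sub, intervalIntegral.integral_const_mul,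
      intervalIntegral.integral_const_mul] at h
    · simp at h
      rw [show 2 * (n + 1) + 1 = (2 * n + 1) + 1 + 1 by ring, Nat.factorial_succ,
        Nat.factorial_succ (2 * n + 1), Nat.factorial_succ n]
      push_cast
      linear_combination (2 * n + 2) * ((2 * n + 1).factorial : ℝ) * h + (2 * n + 2) ^ 2 * ih
    · exact (Continuous.intervalIntegrable (by fun_prop) _ _)
    · exact (Continuous.intervalIntegrable (by fun_prop) _ _)

lemma iterate_derivative_leg_self (n : ℕ) :
    derivative^[n] (leg n) = C (((2 * n).factorial : ℝ) / (2 ^ n * n.factorial)) := by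
  have hn : (leg n).natDegree = n := natDegree_eq_of_degree_eq_some (degree_leg n)
  have h0 : (derivative^[n] (leg n)).natDegree = 0 := by
    have := natDegree_iterate_derivative (leg n) n
    omega
  rw [eq_C_of_natDegree_eq_zero h0, coeff_iterate_derivative, zero_add, Nat.descFactorial_self]
  have hs : (jacobiShift 0 0 n).natDegree = n := by
    have := hn
    rwa [leg, jacobiP_eq_comp, natDegree_comp, natDegree_half_mul_sub, mul_one] at this
  have hl : (leg n).coeff n = ((n + n).choose n : ℝ) * (1 / 2) ^ n := by
    have : (leg n).coeff n = (leg n).leadingCoeff := by rw [leadingCoeff, hn]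
    rw [this, leg, jacobiP_eq_comp, leadingCoeff_comp (by rw [natDegree_half_mul_sub]; simp), hs,
      leadingCoeff, hs, coeff_legShift, leadingCoeff_mul, leadingCoeff_C, ← C_1,
      leadingCoeff_X_sub_C]
    simp
  rw [hl, Nat.cast_choose ℝ (Nat.le_add_left n n), Nat.add_sub_cancel]
  have h1 : (n.factorial : ℝ) ≠ 0 := by exact_mod_cast n.factorial_ne_zero
  congr 1
  rw [← two_mul, nsmul_eq_mul, one_div, inv_pow]
  field_simp

lemma integral_leg_mul_self (n : ℕ) :
    ∫ x in (-1 : ℝ)..1, (leg n * leg n).eval x = 2 / (2 * n + 1) := by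
  have h := integral_weight_mul_derivative n n (leg n)
  rw [iterate_derivative_leg_self] at h
  simp only [eval_mul, eval_C, eval_pow, eval_sub, eval_one, eval_X, mul_assoc] at h
  rw [intervalIntegral.integral_mul_const] at h
  have h1 := integral_weight_pow n
  have h2 := legLam_mul_factorial (le_refl n)
  simp only [Nat.sub_self, Nat.factorial_zero, Nat.cast_one, mul_one, ← two_mul] at h2
  rw [h2] at h
  rw [Nat.factorial_succ] at h1
  push_cast at h1
  have f1 : (n.factorial : ℝ) ≠ 0 := by exact_mod_cast n.factorial_ne_zero
  have f2 : ((2 * n).factorial : ℝ) ≠ 0 := by exact_mod_cast (2 * n).factorial_ne_zero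
  have f3 : (2 * (n : ℝ) + 1) ≠ 0 := by positivity
  simp only [eval_mul]
  generalize (∫ x in (-1 : ℝ)..1, (1 - x ^ 2) ^ n) = A at *
  generalize (∫ x in (-1 : ℝ)..1, (leg n).eval x * (leg n).eval x) = B at *
  have hA : A = 2 ^ (2 * n + 1) * (n.factorial : ℝ) ^ 2 / ((2 * n + 1) * (2 * n).factorial) := by
    rw [eq_div_iff (by positivity), h1]
  rw [hA] at h
  have : ((2 * n).factorial : ℝ) * B = (2 * n).factorial * (2 / (2 * n + 1)) := by
    rw [← h]
    field_simp
    ring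
  exact mul_left_cancel₀ f2 this

lemma pow_le_legLam {N n k : ℕ} (hk : k ≤ N) (hn : N ≤ n) :
    (N : ℝ) ^ (2 * k) ≤ (k : ℝ) ^ k * legLam n k := by
  have e1 : (N : ℝ) ^ (2 * k) = ∏ _i ∈ Finset.range k, (N : ℝ) ^ 2 := by
    rw [Finset.prod_const, Finset.card_range, pow_mul]
  have e2 : (k : ℝ) ^ k = ∏ _i ∈ Finset.range k, (k : ℝ) := by
    rw [Finset.prod_const, Finset.card_range]
  rw [e1, e2, legLam, ← Finset.prod_mul_distrib]
  refine Finset.prod_le_prod (fun _ _ => by positivity) fun i hi => ?_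
  have hi' : (i : ℝ) + 1 ≤ k := by exact_mod_cast Finset.mem_range.1 hi
  have hk' : (k : ℝ) ≤ N := by exact_mod_cast hk
  have hn' : (N : ℝ) ≤ n := by exact_mod_cast hn
  have hi0 : (0 : ℝ) ≤ i := by positivity
  -- Since i ≤ k-1, k(n-i) ≥ k(N-k+1) = N + (k-1)(N-k) ≥ N. The other factor n+i+1 exceeds N
  -- trivially.
  have h1 : (N : ℝ) ≤ k * (n - i) := by nlinarith
  rw [← mul_assoc, sq]
  exact mul_le_mul h1 (by linarith) (by positivity) (le_trans (by positivity) h1)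

/-! ### Test functions with Jacobi weights -/

/-- Smooth profiles that vanish on `(-∞, 1)` and are constant on `(2, ∞)`. -/
structure IsProfile (T : ℝ → ℝ) (c : ℝ) : Prop where
  contDiff : ContDiff ℝ ∞ T
  eq_zero : ∀ s < 1, T s = 0
  eq_const : ∀ s, 2 < s → T s = c

lemma IsProfile.bounded {T : ℝ → ℝ} {c : ℝ} (hT : IsProfile T c) :
    ∃ M, 0 ≤ M ∧ ∀ s, |T s| ≤ M := by
  obtain ⟨M, hM⟩ := (isCompact_Icc (a := (0 : ℝ)) (b := 3)).exists_bound_of_continuousOn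
    hT.contDiff.continuous.continuousOn
  refine ⟨max M |c|, le_max_of_le_right (abs_nonneg _), fun s => ?_⟩
  rcases lt_or_ge s 1 with h | h
  · rw [hT.eq_zero s h, abs_zero]
    exact le_max_of_le_right (abs_nonneg _)
  · rcases lt_or_ge 2 s with h2 | h2
    · rw [hT.eq_const s h2]
      exact le_max_right _ _
    · exact le_max_of_le_left (hM s ⟨by linarith, by linarith⟩)

/-- Differentiating the cut-off T((1-x²)/ε) costs 1/ε. Taking one factor 1-x² = εs from the weight
pays for it and leaves sT'(s), which is again a profile; this closes the induction for the uniform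
bounds. -/
lemma IsProfile.mul_deriv {T : ℝ → ℝ} {c : ℝ} (hT : IsProfile T c) :
    IsProfile (fun s => s * deriv T s) 0 where
  contDiff := contDiff_id.mul ((contDiff_infty_iff_deriv.1 hT.contDiff).2)
  eq_zero s hs := by
    have : T =ᶠ[𝓝 s] fun _ => 0 := by
      filter_upwards [Iio_mem_nhds hs] with y hy using hT.eq_zero y hy
    rw [this.deriv_eq]
    simp
  eq_const s hs := by
    have : T =ᶠ[𝓝 s] fun _ => c := by
      filter_upwards [Ioi_mem_nhds hs] with y hy using hT.eq_const y hy
    rw [this.deriv_eq]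
    simp

lemma isProfile_smoothTransition : IsProfile (fun s => Real.smoothTransition (s - 1)) 1 where
  contDiff := Real.smoothTransition.contDiff.comp (contDiff_id.sub contDiff_const)
  eq_zero s hs := Real.smoothTransition.zero_of_nonpos (by linarith)
  eq_const s hs := Real.smoothTransition.one_of_one_le (by linarith)

/-- The weighted polynomial `(1-x²)^a q(x)` cut off near `±1`. -/
def cutPoly (T : ℝ → ℝ) (ε : ℝ) (a : ℕ) (q : ℝ[X]) (x : ℝ) : ℝ :=
  T ((1 - x ^ 2) / ε) * ((1 - X ^ 2) ^ a * q).eval x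

lemma cutPoly_contDiff {T : ℝ → ℝ} {c : ℝ} (hT : IsProfile T c) (ε : ℝ) (a : ℕ) (q : ℝ[X]) :
    ContDiff ℝ ∞ (cutPoly T ε a q) := by
  have h1 : ContDiff ℝ ∞ fun x : ℝ => (1 - x ^ 2) / ε := by fun_prop
  exact (hT.contDiff.comp h1).mul (Polynomial.contDiff_aeval _ _)

lemma deriv_cutPoly {T : ℝ → ℝ} {c : ℝ} (hT : IsProfile T c) {ε : ℝ} (hε : ε ≠ 0) (a : ℕ)
    (q : ℝ[X]) :
    deriv (cutPoly T ε (a + 1) q) = cutPoly (fun s => s * deriv T s) ε a (C (-2) * X * q) +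
      cutPoly T ε a (C (-2 * (a + 1 : ℝ)) * X * q + (1 - X ^ 2) * derivative q) := by
  ext x
  have h1 : HasDerivAt (fun x : ℝ => (1 - x ^ 2) / ε) (-(2 * x) / ε) x := by
    have := ((hasDerivAt_pow 2 x).const_sub 1).div_const ε
    simpa using this
  have h2 : HasDerivAt T (deriv T ((1 - x ^ 2) / ε)) ((1 - x ^ 2) / ε) :=
    (hT.contDiff.differentiable (by simp)).differentiableAt.hasDerivAt
  have h3 := (h2.comp x h1).mul (((1 - X ^ 2) ^ (a + 1) * q).hasDerivAt x)
  have h4 : deriv (cutPoly T ε (a + 1) q) x = _ := h3.deriv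
  rw [h4, Pi.add_apply, cutPoly, cutPoly]
  rw [derivative_mul, derivative_pow_succ]
  simp
  field_simp
  ring

/-- The bound is uniform in ε because each derivative consumes one power of 1-x². The profile and
the polynomial are quantified inside the induction, since `deriv_cutPoly` changes both. -/
lemma cutPoly_iteratedDeriv_bounded (a : ℕ) : ∀ {T : ℝ → ℝ} {c : ℝ}, IsProfile T c →
    ∀ q : ℝ[X], ∃ M, ∀ ε, 0 < ε → ∀ x ∈ Ioo (-1 : ℝ) 1,
      |iteratedDeriv a (cutPoly T ε a q) x| ≤ M := by
  induction a with
  | zero =>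
    intro T c hT q
    obtain ⟨M, hM0, hM⟩ := hT.bounded
    obtain ⟨K, hK⟩ := (isCompact_Icc (a := (-1 : ℝ)) (b := 1)).exists_bound_of_continuousOn
      q.continuous.continuousOn
    refine ⟨M * K, fun ε hε x hx => ?_⟩
    simp only [iteratedDeriv_zero, cutPoly, pow_zero, one_mul, abs_mul]
    exact mul_le_mul (hM _) (hK x (Ioo_subset_Icc_self hx)) (abs_nonneg _) hM0
  | succ a ih =>
    intro T c hT q
    obtain ⟨M1, h1⟩ := ih hT.mul_deriv (C (-2) * X * q)
    obtain ⟨M2, h2⟩ := ih hT (C (-2 * (a + 1 : ℝ)) * X * q + (1 - X ^ 2) * derivative q)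
    refine ⟨M1 + M2, fun ε hε x hx => ?_⟩
    rw [iteratedDeriv_succ', deriv_cutPoly hT hε.ne', iteratedDeriv_add
      ((cutPoly_contDiff hT.mul_deriv ε a _).contDiffAt.of_le (by exact_mod_cast le_top))
      ((cutPoly_contDiff hT ε a _).contDiffAt.of_le (by exact_mod_cast le_top))]
    exact (abs_add_le _ _).trans (add_le_add (h1 ε hε x hx) (h2 ε hε x hx))

lemma iteratedDeriv_polynomial (k : ℕ) (p : ℝ[X]) :
    iteratedDeriv k (fun x => p.eval x) = fun x => (derivative^[k] p).eval x := by
  induction k generalizing p with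
  | zero => simp
  | succ k ih =>
    have : deriv (fun x => p.eval x) = fun x => (derivative p).eval x := by
      ext x
      exact p.deriv
    rw [iteratedDeriv_succ', this, ih, Function.iterate_succ_apply]

lemma cutPoly_iteratedDeriv_tendsto {T : ℝ → ℝ} (hT : IsProfile T 1) (k a : ℕ) (q : ℝ[X])
    {ε : ℕ → ℝ} (hε0 : ∀ i, 0 < ε i) (hε : Tendsto ε atTop (𝓝 0)) {x : ℝ}
    (hx : x ∈ Ioo (-1 : ℝ) 1) :
    Tendsto (fun i => iteratedDeriv k (cutPoly T (ε i) a q) x) atTop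
      (𝓝 ((derivative^[k] ((1 - X ^ 2) ^ a * q)).eval x)) := by
  -- At a fixed interior point the sequence is eventually constant: once 2ε < 1-x² the cut-off
  -- equals 1 near x.
  refine tendsto_const_nhds.congr' ?_
  have hx2 : 0 < 1 - x ^ 2 := by nlinarith [hx.1, hx.2]
  filter_upwards [hε.eventually (gt_mem_nhds (show (0 : ℝ) < (1 - x ^ 2) / 2 by positivity))]
    with i hi
  have hc : ContinuousAt (fun y : ℝ => (1 - y ^ 2) / ε i) x := by fun_prop
  have h2 : 2 < (1 - x ^ 2) / ε i := by
    rw [lt_div_iff₀ (hε0 i)]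
    linarith
  have : cutPoly T (ε i) a q =ᶠ[𝓝 x] fun y => ((1 - X ^ 2) ^ a * q).eval y := by
    filter_upwards [hc.eventually (lt_mem_nhds h2)] with y hy
    rw [cutPoly, hT.eq_const _ hy, one_mul]
  rw [this.iteratedDeriv_eq, iteratedDeriv_polynomial]

/-- The cut-off weighted polynomial as a test function. -/
def cutTest {T : ℝ → ℝ} {c : ℝ} (hT : IsProfile T c) {ε : ℝ} (hε : 0 < ε) (a : ℕ) (q : ℝ[X]) :
    𝓓(Lam, ℝ) := by
  have hsub : tsupport (cutPoly T ε a q) ⊆ {x | ε ≤ 1 - x ^ 2} := by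
    refine closure_minimal ?_ (isClosed_le continuous_const (by fun_prop))
    intro x hx
    by_contra h
    rw [mem_ofPred_eq, not_le] at h
    refine hx ?_
    rw [cutPoly, hT.eq_zero _ (by rwa [div_lt_one hε]), zero_mul]
  have hsub2 : {x : ℝ | ε ≤ 1 - x ^ 2} ⊆ Ioo (-1) 1 := by
    intro x hx
    rw [mem_ofPred_eq] at hx
    constructor <;> nlinarith
  refine ⟨cutPoly T ε a q, cutPoly_contDiff hT ε a q, ?_, hsub.trans hsub2⟩
  refine (isCompact_Icc (a := (-1 : ℝ)) (b := 1)).of_isClosed_subset (isClosed_tsupport _) ?_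
  exact (hsub.trans hsub2).trans Ioo_subset_Icc_self

lemma coe_cutTest {T : ℝ → ℝ} {c : ℝ} (hT : IsProfile T c) {ε : ℝ} (hε : 0 < ε) (a : ℕ)
    (q : ℝ[X]) : (cutTest hT hε a q : ℝ → ℝ) = cutPoly T ε a q := rfl

instance : IsFiniteMeasure lamMeasure := by
  unfold lamMeasure
  infer_instance

lemma ae_mem_Ioo : ∀ᵐ x ∂lamMeasure, x ∈ Ioo (-1 : ℝ) 1 := ae_restrict_mem measurableSet_Ioo

/-- The defining identity of a weak derivative of order `k` extends from test functions to the
polynomials `(1-x²)^k p`. -/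
lemma integral_weak_weight {k : ℕ} {h g : ℝ → ℝ} {σ : ℝ} (hh : Integrable h lamMeasure)
    (hg : LocallyIntegrableOn g (Ioo (-1) 1))
    (hgk : Integrable (fun x => g x * (1 - x ^ 2) ^ k) lamMeasure)
    (H : ∀ φ : 𝓓(Lam, ℝ),
      ∫ x, h x * iteratedDeriv k φ x ∂lamMeasure = σ * ∫ x, g x * φ x ∂lamMeasure)
    (p : ℝ[X]) :
    ∫ x, h x * (derivative^[k] ((1 - X ^ 2) ^ k * p)).eval x ∂lamMeasure =
      σ * ∫ x, g x * ((1 - X ^ 2) ^ k * p).eval x ∂lamMeasure := by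
  obtain ⟨T, hT⟩ : ∃ T, IsProfile T 1 := ⟨_, isProfile_smoothTransition⟩
  set ε : ℕ → ℝ := fun i => 1 / ((i : ℝ) + 1) with hεdef
  have hε0 : ∀ i, 0 < ε i := fun i => by positivity
  have hε : Tendsto ε atTop (𝓝 0) := tendsto_one_div_add_atTop_nhds_zero_nat
  obtain ⟨M, hM⟩ := cutPoly_iteratedDeriv_bounded k hT p
  obtain ⟨B, hB0, hB⟩ := hT.bounded
  obtain ⟨K, hK⟩ := (isCompact_Icc (a := (-1 : ℝ)) (b := 1)).exists_bound_of_continuousOn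
      p.continuous.continuousOn
  -- Dominated convergence on both sides: on the left by the uniform bound on k derivatives, on the
  -- right by the weight (1-x²)^k, which makes g integrable up to ±1.
  have L : Tendsto (fun i => ∫ x, h x * iteratedDeriv k (cutPoly T (ε i) k p) x ∂lamMeasure) atTop
      (𝓝 (∫ x, h x * (derivative^[k] ((1 - X ^ 2) ^ k * p)).eval x ∂lamMeasure)) := by
    refine tendsto_integral_of_dominated_convergence (fun x => |h x| * M) (fun i => ?_)
      (hh.abs.mul_const M) (fun i => ?_) ?_
    · exact hh.aestronglyMeasurable.mul ((cutPoly_contDiff hT _ _ _).continuous_iteratedDeriv k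
        (by exact_mod_cast le_top)).aestronglyMeasurable
    · filter_upwards [ae_mem_Ioo] with x hx
      rw [norm_mul, Real.norm_eq_abs, Real.norm_eq_abs]
      exact mul_le_mul_of_nonneg_left (hM _ (hε0 i) x hx) (abs_nonneg _)
    · filter_upwards [ae_mem_Ioo] with x hx
      exact (cutPoly_iteratedDeriv_tendsto hT k k p hε0 hε hx).const_mul _
  have R : Tendsto (fun i => ∫ x, g x * cutPoly T (ε i) k p x ∂lamMeasure) atTop
      (𝓝 (∫ x, g x * ((1 - X ^ 2) ^ k * p).eval x ∂lamMeasure)) := by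
    refine tendsto_integral_of_dominated_convergence
      (fun x => |g x * (1 - x ^ 2) ^ k| * (B * K)) (fun i => ?_)
      (hgk.abs.mul_const _) (fun i => ?_) ?_
    · have := integrable_mul_test hg (cutTest hT (hε0 i) k p) 0
      exact this.aestronglyMeasurable
    · filter_upwards [ae_mem_Ioo] with x hx
      have e : g x * cutPoly T (ε i) k p x =
          g x * (1 - x ^ 2) ^ k * (T ((1 - x ^ 2) / ε i) * p.eval x) := by
        simp [cutPoly]
        ring
      rw [e, norm_mul, Real.norm_eq_abs, Real.norm_eq_abs, abs_mul (T _)]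
      refine mul_le_mul_of_nonneg_left ?_ (abs_nonneg _)
      exact mul_le_mul (hB _) (hK x (Ioo_subset_Icc_self hx)) (abs_nonneg _) hB0
    · filter_upwards [ae_mem_Ioo] with x hx
      exact (cutPoly_iteratedDeriv_tendsto hT 0 k p hε0 hε hx).const_mul _
  refine tendsto_nhds_unique L ((R.const_mul σ).congr fun i => ?_)
  exact (H (cutTest hT (hε0 i) k p)).symm

/-- A function in `H¹₀(Λ)` has a derivative of mean zero. -/
lemma integral_weakDeriv_eq_zero {v s c : ℝ → ℝ} (hv : HasWeakDeriv 1 v s)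
    (hs : Integrable s lamMeasure) (hc : ContinuousOn c (Icc (-1) 1)) (hc1 : c (-1) = 0)
    (hc2 : c 1 = 0) (hvc : v =ᵐ[lamMeasure] c) : ∫ x, s x ∂lamMeasure = 0 := by
  obtain ⟨T, hT⟩ : ∃ T, IsProfile T 1 := ⟨_, isProfile_smoothTransition⟩
  set ε : ℕ → ℝ := fun i => 1 / ((i : ℝ) + 1) with hεdef
  have hε0 : ∀ i, 0 < ε i := fun i => by positivity
  have hε : Tendsto ε atTop (𝓝 0) := tendsto_one_div_add_atTop_nhds_zero_nat
  obtain ⟨B, hB0, hB⟩ := hT.bounded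
  obtain ⟨D, hD0, hD⟩ := hT.mul_deriv.bounded
  have R : Tendsto (fun i => ∫ x, s x * cutPoly T (ε i) 0 1 x ∂lamMeasure) atTop
      (𝓝 (∫ x, s x ∂lamMeasure)) := by
    refine tendsto_integral_of_dominated_convergence (fun x => |s x| * B) (fun i => ?_)
      (hs.abs.mul_const _) (fun i => ?_) ?_
    · exact hs.aestronglyMeasurable.mul (cutPoly_contDiff hT _ _ _).continuous.aestronglyMeasurable
    · filter_upwards with x
      rw [norm_mul, Real.norm_eq_abs, Real.norm_eq_abs]
      refine mul_le_mul_of_nonneg_left ?_ (abs_nonneg _)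
      simpa [cutPoly] using hB _
    · filter_upwards [ae_mem_Ioo] with x hx
      have := (cutPoly_iteratedDeriv_tendsto hT 0 0 1 hε0 hε hx).const_mul (s x)
      simpa using this
  -- The derivative of the cut-off is O(1/e) and lives in a boundary layer of width O(e), where v is
  -- small. So its integral against v tends to 0, while that of s against the cut-off tends to the
  -- integral of s.
  have Hd : ∀ e : ℝ, 0 < e → ∀ x ∈ Ioo (-1 : ℝ) 1, |deriv (cutPoly T e 0 1) x| ≤ 2 * D / e ∧
      (2 * e < 1 - x ^ 2 → deriv (cutPoly T e 0 1) x = 0) := by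
    intro e he x hx
    have h1 : HasDerivAt (fun x : ℝ => (1 - x ^ 2) / e) (-(2 * x) / e) x := by
      simpa using ((hasDerivAt_pow 2 x).const_sub 1).div_const e
    have h2 : HasDerivAt T (deriv T ((1 - x ^ 2) / e)) ((1 - x ^ 2) / e) :=
      (hT.contDiff.differentiable (by simp)).differentiableAt.hasDerivAt
    have h3 : cutPoly T e 0 1 = T ∘ fun x : ℝ => (1 - x ^ 2) / e := by
      ext y
      simp [cutPoly]
    rw [h3, (h2.comp x h1).deriv]
    have hT1 := hD ((1 - x ^ 2) / e)
    set y := (1 - x ^ 2) / e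
    constructor
    · have hT2 : |deriv T y| ≤ D := by
        rcases lt_or_ge y 1 with hy | hy
        · have : T =ᶠ[𝓝 y] fun _ => 0 := by
            filter_upwards [Iio_mem_nhds hy] with z hz using hT.eq_zero z hz
          rw [this.deriv_eq]
          simpa using hD0
        -- D bounds sT'(s), hence also T'(s) where s ≥ 1; for s < 1 the derivative is 0.
        · refine le_trans ?_ hT1
          rw [abs_mul, abs_of_nonneg (by linarith : 0 ≤ y)]
          exact le_mul_of_one_le_left (abs_nonneg _) hy
      have hx2 : |-(2 * x) / e| ≤ 2 / e := by
        rw [abs_div, abs_neg, abs_of_pos he, abs_mul, abs_two]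
        gcongr
        linarith [abs_le.2 ⟨hx.1.le, hx.2.le⟩]
      rw [abs_mul, mul_comm 2 D, mul_div_assoc]
      exact mul_le_mul hT2 hx2 (abs_nonneg _) hD0
    · intro hlt
      have hy : 2 < y := by rwa [lt_div_iff₀ he]
      have : T =ᶠ[𝓝 y] fun _ => 1 := by
        filter_upwards [Ioi_mem_nhds hy] with z hz using hT.eq_const z hz
      rw [this.deriv_eq]
      simp
  have Hc : ∀ δ > 0, ∃ η > 0, ∀ x ∈ Ioo (-1 : ℝ) 1, 1 - x ^ 2 ≤ η → |c x| ≤ δ := by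
    intro δ hδ
    obtain ⟨r, hr0, hr⟩ := Metric.continuousWithinAt_iff.1 (hc 1 (by simp)) δ hδ
    obtain ⟨r', hr0', hr'⟩ := Metric.continuousWithinAt_iff.1 (hc (-1) (by simp)) δ hδ
    refine ⟨min r r' / 2, by positivity, fun x hx hxη => ?_⟩
    have m1 := min_le_left r r'
    have m2 := min_le_right r r'
    have m0 : 0 < min r r' := lt_min hr0 hr0'
    rcases le_total 0 x with h0 | h0
    · have := hr (Ioo_subset_Icc_self hx) (by
        rw [Real.dist_eq, abs_sub_comm, abs_of_nonneg (by linarith [hx.2])]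
        nlinarith [hx.1, hx.2])
      rw [hc2, Real.dist_eq, sub_zero] at this
      exact this.le
    · have := hr' (Ioo_subset_Icc_self hx) (by
        rw [Real.dist_eq, abs_of_nonneg (by linarith [hx.1])]
        nlinarith [hx.1, hx.2])
      rw [hc1, Real.dist_eq, sub_zero] at this
      exact this.le
  have Hint : ∀ δ > 0, ∀ᶠ i in atTop,
      |∫ x, v x * deriv (cutPoly T (ε i) 0 1) x ∂lamMeasure| ≤ δ * (8 * D) := by
    intro δ hδ
    obtain ⟨η, hη0, hη⟩ := Hc δ hδ
    filter_upwards [hε.eventually (gt_mem_nhds (show (0 : ℝ) < η / 2 by positivity))] with i hi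
    have hei := hε0 i
    set e := ε i
    set S : Set ℝ := Icc (-1) (-1 + 2 * e) ∪ Icc (1 - 2 * e) 1 with hS
    have hSm : MeasurableSet S := measurableSet_Icc.union measurableSet_Icc
    have hvol : lamMeasure.real S ≤ 4 * e := by
      have h1 : lamMeasure.real S ≤ lamMeasure.real (Icc (-1) (-1 + 2 * e)) +
          lamMeasure.real (Icc (1 - 2 * e) 1) := measureReal_union_le _ _
      have h2 : ∀ a b : ℝ, a ≤ b → lamMeasure.real (Icc a b) ≤ b - a := by
        intro a b hab
        rw [← Real.volume_real_Icc_of_le hab]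
        exact ENNReal.toReal_mono (by simp) (Measure.restrict_le_self _)
      have h3 := h2 (-1) (-1 + 2 * e) (by linarith)
      have h4 := h2 (1 - 2 * e) 1 (by linarith)
      linarith
    have hb : ∀ᵐ x ∂lamMeasure, ‖v x * deriv (cutPoly T e 0 1) x‖ ≤
        S.indicator (fun _ => δ * (2 * D / e)) x := by
      filter_upwards [ae_mem_Ioo, hvc] with x hx hvx
      obtain ⟨d1, d2⟩ := Hd e hei x hx
      rcases lt_or_ge (2 * e) (1 - x ^ 2) with h | h
      · rw [d2 h, mul_zero, norm_zero]
        exact indicator_nonneg (fun _ _ => by positivity) x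
      -- 1-x² is at least the distance from x to the nearer endpoint.
      · have hxS : x ∈ S := by
          rcases le_total 0 x with h0 | h0
          · exact Or.inr ⟨by nlinarith [hx.1, hx.2], hx.2.le⟩
          · exact Or.inl ⟨hx.1.le, by nlinarith [hx.1, hx.2]⟩
        rw [indicator_of_mem hxS, norm_mul, Real.norm_eq_abs, Real.norm_eq_abs, hvx]
        exact mul_le_mul (hη x hx (by linarith)) d1 (abs_nonneg _) hδ.le
    have h5 := norm_integral_le_of_norm_le ((integrable_const _).indicator hSm) hb
    rw [integral_indicator_const _ hSm, smul_eq_mul, Real.norm_eq_abs] at h5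
    refine h5.trans ?_
    calc lamMeasure.real S * (δ * (2 * D / e)) ≤ 4 * e * (δ * (2 * D / e)) := by gcongr
      _ = δ * (8 * D) := by field_simp; ring
  have Heq : ∀ i, ∫ x, v x * deriv (cutPoly T (ε i) 0 1) x ∂lamMeasure =
      -∫ x, s x * cutPoly T (ε i) 0 1 x ∂lamMeasure := by
    intro i
    have := hv.2.2 (cutTest hT (hε0 i) 0 1)
    rw [coe_cutTest, iteratedDeriv_one] at this
    rw [this]
    ring
  have hle : ∀ δ > 0, |∫ x, s x ∂lamMeasure| ≤ δ * (8 * D) := by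
    intro δ hδ
    refine le_of_tendsto R.abs ?_
    filter_upwards [Hint δ hδ] with i hi
    rwa [Heq, abs_neg] at hi
  rw [← abs_nonpos_iff]
  refine le_of_forall_pos_le_add fun δ hδ => ?_
  refine (hle (δ / (8 * D + 1)) (by positivity)).trans ?_
  rw [zero_add, div_mul_eq_mul_div, div_le_iff₀ (by positivity)]
  nlinarith

/-! ### Weak derivatives -/

lemma HasWeakDeriv.unique {k : ℕ} {v g g' : ℝ → ℝ} (h : HasWeakDeriv k v g)
    (h' : HasWeakDeriv k v g') : g =ᵐ[lamMeasure] g' := by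
  have key := isOpen_Ioo.ae_eq_zero_of_integral_contDiff_smul_eq_zero (h.2.1.sub h'.2.1)
    (fun φ hφ hφc hφs => ?_) (μ := volume)
  · rw [lamMeasure, EventuallyEq, ae_restrict_iff' measurableSet_Ioo]
    filter_upwards [key] with x hx hxI
    exact sub_eq_zero.1 (hx hxI)
  · let ψ : 𝓓(Lam, ℝ) := ⟨φ, hφ, hφc, hφs⟩
    have e := (h.2.2 ψ).symm.trans (h'.2.2 ψ)
    have e1 : ∫ x, g x * ψ x ∂lamMeasure = ∫ x, g' x * ψ x ∂lamMeasure :=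
      mul_left_cancel₀ (pow_ne_zero k (by norm_num)) e
    have hz : ∀ x ∉ Ioo (-1 : ℝ) 1, φ x • (g - g') x = 0 := by
      intro x hx
      rw [image_eq_zero_of_notMem_tsupport fun h => hx (hφs h), zero_smul]
    rw [← setIntegral_eq_integral_of_forall_compl_eq_zero hz]
    have i1 := integrable_mul_test h.2.1 ψ 0
    have i2 := integrable_mul_test h'.2.1 ψ 0
    simp only [iteratedDeriv_zero] at i1 i2
    have e2 := integral_sub i1 i2
    rw [e1, sub_self] at e2
    rw [← e2]
    refine integral_congr_ae (ae_of_all _ fun x => ?_)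
    change φ x * (g x - g' x) = g x * φ x - g' x * φ x
    ring

lemma hasWeakDeriv_one_of_contDiff {p : ℝ → ℝ} (hp : ContDiff ℝ 1 p) :
    HasWeakDeriv 1 p (deriv p) := by
  have hd : Continuous (deriv p) := hp.continuous_deriv le_rfl
  refine ⟨hp.continuous.locallyIntegrable.locallyIntegrableOn _,
    hd.locallyIntegrable.locallyIntegrableOn _, fun φ => ?_⟩
  have hφd : Continuous (deriv φ) := φ.contDiff.continuous_deriv (by simp)
  have hφs : ∀ x ∉ Ioo (-1 : ℝ) 1, φ x = 0 := fun x hx =>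
    image_eq_zero_of_notMem_tsupport fun h => hx (φ.tsupport_subset h)
  have hφs' : ∀ x ∉ Ioo (-1 : ℝ) 1, deriv φ x = 0 := fun x hx => by
    by_contra h
    exact hx (φ.tsupport_subset (support_deriv_subset h))
  have hk := integral_mul_deriv_eq_deriv_mul_of_integrable (u := p) (u' := deriv p) (v := φ)
    (v' := deriv φ) (fun x _ => (hp.differentiable (by simp)).differentiableAt.hasDerivAt)
    (fun x _ => (φ.contDiff.differentiable (by simp)).differentiableAt.hasDerivAt)
    ((hp.continuous.mul hφd).integrable_of_hasCompactSupport φ.hasCompactSupport.deriv.mul_left)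
    ((hd.mul φ.continuous).integrable_of_hasCompactSupport φ.hasCompactSupport.mul_left)
    ((hp.continuous.mul φ.continuous).integrable_of_hasCompactSupport φ.hasCompactSupport.mul_left)
  rw [iteratedDeriv_one, lamMeasure,
    setIntegral_eq_integral_of_forall_compl_eq_zero (fun x hx => by rw [hφs' x hx, mul_zero]),
    setIntegral_eq_integral_of_forall_compl_eq_zero (fun x hx => by rw [hφs x hx, mul_zero]), hk]
  ring

lemma hasWeakDeriv_one_polynomial (p : ℝ[X]) :
    HasWeakDeriv 1 (fun x => p.eval x) (fun x => (derivative p).eval x) := by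
  have h := hasWeakDeriv_one_of_contDiff (p := fun x => p.eval x) (Polynomial.contDiff_aeval p 1)
  have : deriv (fun x => p.eval x) = fun x => (derivative p).eval x := by
    ext x
    exact p.deriv
  rwa [this] at h

/-! ### Polynomials in `L²` spaces on `Λ` -/

lemma memLp_polynomial (ν : Measure ℝ) [IsFiniteMeasure ν] (hν : ν ≪ lamMeasure) (p : ℝ[X]) :
    MemLp (fun x => p.eval x) 2 ν := by
  obtain ⟨K, hK⟩ := (isCompact_Icc (a := (-1 : ℝ)) (b := 1)).exists_bound_of_continuousOn
    p.continuous.continuousOn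
  refine MemLp.of_bound p.continuous.aestronglyMeasurable K ?_
  filter_upwards [hν.ae_le ae_mem_Ioo] with x hx using hK x (Ioo_subset_Icc_self hx)

/-- Polynomials as elements of `L²(ν)`, where `ν` is a finite measure on `Λ`. -/
def polyLp (ν : Measure ℝ) [IsFiniteMeasure ν] (hν : ν ≪ lamMeasure) : ℝ[X] →ₗ[ℝ] Lp ℝ 2 ν where
  toFun p := (memLp_polynomial ν hν p).toLp
  map_add' p q := by
    rw [← MemLp.toLp_add]
    exact MemLp.toLp_congr _ _ (ae_of_all _ fun x => by simp)
  map_smul' c p := by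
    rw [RingHom.id_apply, ← MemLp.toLp_const_smul]
    exact MemLp.toLp_congr _ _ (ae_of_all _ fun x => by simp)

lemma coeFn_polyLp (ν : Measure ℝ) [IsFiniteMeasure ν] (hν : ν ≪ lamMeasure) (p : ℝ[X]) :
    polyLp ν hν p =ᵐ[ν] fun x => p.eval x := (memLp_polynomial ν hν p).coeFn_toLp

lemma inner_polyLp (ν : Measure ℝ) [IsFiniteMeasure ν] (hν : ν ≪ lamMeasure) (f : Lp ℝ 2 ν)
    (p : ℝ[X]) : inner ℝ f (polyLp ν hν p) = ∫ x, f x * p.eval x ∂ν := by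
  rw [L2.inner_def]
  refine integral_congr_ae ?_
  filter_upwards [coeFn_polyLp ν hν p] with x hx
  rw [hx]
  simp [mul_comm]

lemma inner_polyLp_polyLp (ν : Measure ℝ) [IsFiniteMeasure ν] (hν : ν ≪ lamMeasure)
    (p q : ℝ[X]) : inner ℝ (polyLp ν hν p) (polyLp ν hν q) = ∫ x, (p * q).eval x ∂ν := by
  rw [inner_polyLp]
  refine integral_congr_ae ?_
  filter_upwards [coeFn_polyLp ν hν p] with x hx
  rw [hx, eval_mul]

/-- Polynomials as elements of `L²(Λ)`. -/
abbrev polyL2 : ℝ[X] →ₗ[ℝ] L2 := polyLp lamMeasure Measure.AbsolutelyContinuous.rfl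

lemma integral_lamMeasure (f : ℝ → ℝ) : ∫ x, f x ∂lamMeasure = ∫ x in (-1 : ℝ)..1, f x := by
  rw [intervalIntegral.integral_of_le (by norm_num), integral_Ioc_eq_integral_Ioo, lamMeasure]

lemma inner_polyL2 (p q : ℝ[X]) :
    inner ℝ (polyL2 p) (polyL2 q) = ∫ x in (-1 : ℝ)..1, (p * q).eval x := by
  rw [inner_polyLp_polyLp, integral_lamMeasure]

lemma inner_leg_of_ne {n j : ℕ} (h : n ≠ j) : inner ℝ (polyL2 (leg n)) (polyL2 (leg j)) = 0 := by
  rw [inner_polyL2, integral_leg_mul_leg_of_ne h]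

lemma inner_leg_self (n : ℕ) :
    inner ℝ (polyL2 (leg n)) (polyL2 (leg n)) = 2 / (2 * (n : ℝ) + 1) := by
  rw [inner_polyL2, integral_leg_mul_self]

lemma denseRange_polyL2 : DenseRange polyL2 := by
  intro e
  rw [Metric.mem_closure_range_iff]
  intro ε hε
  obtain ⟨g, hg, hgm⟩ := (Lp.memLp e).exists_boundedContinuous_eLpNorm_sub_le
    (by simp) (ε := ENNReal.ofReal (ε / 4)) (by simpa using hε)
  obtain ⟨p, hp⟩ := exists_polynomial_near_of_continuousOn (-1) 1 g
    g.continuous.continuousOn (ε / 4) (by positivity)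
  refine ⟨p, ?_⟩
  have h1 : ‖e - hgm.toLp g‖ ≤ ε / 4 := by
    rw [Lp.norm_def]
    refine ENNReal.toReal_le_of_le_ofReal (by positivity) ?_
    refine le_trans (le_of_eq (eLpNorm_congr_ae ?_)) hg
    filter_upwards [Lp.coeFn_sub e (hgm.toLp g), hgm.coeFn_toLp] with x h2 h3
    rw [h2, Pi.sub_apply, Pi.sub_apply, h3]
  have h2 : ‖hgm.toLp g - polyL2 p‖ ≤ 2 * (ε / 4) := by
    have := Lp.norm_le_of_ae_bound (f := hgm.toLp g - polyL2 p) (C := ε / 4) (by positivity) (by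
      filter_upwards [Lp.coeFn_sub (hgm.toLp g) (polyL2 p), hgm.coeFn_toLp,
        coeFn_polyLp lamMeasure Measure.AbsolutelyContinuous.rfl p, ae_mem_Ioo] with x h2 h3 h4 h5
      rw [h2, Pi.sub_apply, h3, h4, norm_sub_rev]
      exact (hp x (Ioo_subset_Icc_self h5)).le)
    refine this.trans ?_
    -- The uniform bound ε/4 is multiplied by the square root of the total mass 2, and √2 ≤ 2.
    gcongr
    have hm : ((measureUnivNNReal lamMeasure : NNReal) : ℝ) = 2 := by
      change (lamMeasure univ).toReal = 2
      rw [lamMeasure, Measure.restrict_apply_univ, Real.volume_Ioo]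
      norm_num
    rw [hm]
    conv_rhs => rw [← Real.rpow_one 2]
    exact Real.rpow_le_rpow_of_exponent_le (by norm_num) (by norm_num)
  rw [dist_eq_norm]
  calc ‖e - polyL2 p‖ = ‖(e - hgm.toLp g) + (hgm.toLp g - polyL2 p)‖ := by congr 1; abel
    _ ≤ ε / 4 + 2 * (ε / 4) := (norm_add_le _ _).trans (add_le_add h1 h2)
    _ < ε := by linarith

/-- By density the inequality extends to all of L², and e itself is then inserted. Testing on
polynomials keeps every Legendre expansion finite. -/
lemma norm_le_of_forall_polyL2 {e : L2} {c : ℝ} (hc : 0 ≤ c)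
    (h : ∀ p, inner ℝ e (polyL2 p) ≤ c * ‖polyL2 p‖) : ‖e‖ ≤ c := by
  have h1 : ∀ y : L2, inner ℝ e y ≤ c * ‖y‖ := isClosed_property denseRange_polyL2
    (isClosed_le (by fun_prop) (by fun_prop)) h
  have h2 := h1 e
  rw [real_inner_self_eq_norm_sq, sq] at h2
  rcases (norm_nonneg e).eq_or_lt with h0 | h0
  · rwa [← h0]
  · exact le_of_mul_le_mul_right h2 h0

lemma norm_sq_sum_of_orthogonal {E : Type*} [NormedAddCommGroup E] [InnerProductSpace ℝ E]
    {ι : Type*} {x : ι → E} (h : ∀ i j, i ≠ j → inner ℝ (x i) (x j) = 0) (s : Finset ι)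
    (a : ι → ℝ) : ‖∑ i ∈ s, a i • x i‖ ^ 2 = ∑ i ∈ s, a i ^ 2 * ‖x i‖ ^ 2 := by
  classical
  rw [← real_inner_self_eq_norm_sq, sum_inner]
  refine Finset.sum_congr rfl fun i hi => ?_
  rw [inner_sum, Finset.sum_eq_single i]
  · rw [real_inner_smul_left, real_inner_smul_right, real_inner_self_eq_norm_sq]
    ring
  · intro j _ hj
    rw [real_inner_smul_left, real_inner_smul_right, h i j hj.symm]
    ring
  · exact fun h => absurd hi h

/-! ### The weighted spaces -/

lemma jacobiWeight_natCast {k : ℕ} {x : ℝ} : jacobiWeight k k x = (1 - x ^ 2) ^ k := by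
  rw [jacobiWeight, Real.rpow_natCast, Real.rpow_natCast, ← mul_pow]
  ring

lemma measurable_jacobi_density (k : ℕ) :
    Measurable fun x => ENNReal.ofReal (jacobiWeight k k x) := by
  simp only [jacobiWeight_natCast]
  fun_prop

instance (k : ℕ) : IsFiniteMeasure (jacobiMeasure k k) := by
  refine isFiniteMeasure_withDensity_ofReal (Integrable.hasFiniteIntegral ?_)
  have := (memLp_polynomial lamMeasure Measure.AbsolutelyContinuous.rfl
    ((1 - X ^ 2) ^ k)).integrable (by norm_num)
  refine this.congr (ae_of_all _ fun x => ?_)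
  simp [jacobiWeight_natCast]

lemma jacobiMeasure_ac (a b : ℝ) : jacobiMeasure a b ≪ lamMeasure :=
  withDensity_absolutelyContinuous _ _

lemma toReal_jacobi_density {k : ℕ} {x : ℝ} (hx : x ∈ Ioo (-1 : ℝ) 1) :
    (ENNReal.ofReal (jacobiWeight k k x)).toReal = (1 - x ^ 2) ^ k := by
  rw [jacobiWeight_natCast, ENNReal.toReal_ofReal]
  have : 0 ≤ 1 - x ^ 2 := by nlinarith [hx.1, hx.2]
  positivity

lemma integral_jacobiMeasure (k : ℕ) (f : ℝ → ℝ) :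
    ∫ x, f x ∂jacobiMeasure k k = ∫ x, f x * (1 - x ^ 2) ^ k ∂lamMeasure := by
  rw [jacobiMeasure, integral_withDensity_eq_integral_toReal_smul (measurable_jacobi_density k)
    (by simp)]
  refine integral_congr_ae ?_
  filter_upwards [ae_mem_Ioo] with x hx
  rw [toReal_jacobi_density hx, smul_eq_mul, mul_comm]

lemma integrable_jacobiMeasure {k : ℕ} {f : ℝ → ℝ} (hf : Integrable f (jacobiMeasure k k)) :
    Integrable (fun x => f x * (1 - x ^ 2) ^ k) lamMeasure := by
  rw [jacobiMeasure, integrable_withDensity_iff_integrable_smul' (measurable_jacobi_density k)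
    (by simp)] at hf
  refine hf.congr ?_
  filter_upwards [ae_mem_Ioo] with x hx
  rw [toReal_jacobi_density hx, smul_eq_mul, mul_comm]

/-- Polynomials as elements of `L²` with the weight `(1-x²)^k`. -/
abbrev polyW (k : ℕ) : ℝ[X] →ₗ[ℝ] Lp ℝ 2 (jacobiMeasure k k) :=
  polyLp (jacobiMeasure k k) (jacobiMeasure_ac _ _)

lemma inner_polyW_derivative (k n j : ℕ) :
    inner ℝ (polyW k (derivative^[k] (leg n))) (polyW k (derivative^[k] (leg j))) =
      legLam n k * inner ℝ (polyL2 (leg n)) (polyL2 (leg j)) := by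
  rw [inner_polyLp_polyLp, integral_jacobiMeasure, integral_lamMeasure, inner_polyL2,
    ← integral_weight_mul_derivative]
  congr 1
  ext x
  simp
  ring

/-! ### Legendre expansions and the projection error. -/

lemma leg_isUnit (n : ℕ) : IsUnit (leg n).leadingCoeff := by
  rw [isUnit_iff_ne_zero, leadingCoeff_ne_zero]
  intro h
  have := degree_leg n
  rw [h] at this
  simp at this

/-- The sequence of Legendre polynomials. -/
def legSeq : Polynomial.Sequence ℝ := ⟨leg, degree_leg⟩

lemma exists_leg_sum (p : ℝ[X]) : ∃ (s : Finset ℕ) (a : ℕ → ℝ), p = ∑ n ∈ s, a n • leg n := by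
  have hb := (legSeq.basis leg_isUnit).linearCombination_repr p
  rw [Finsupp.linearCombination_apply] at hb
  refine ⟨_, (legSeq.basis leg_isUnit).repr p, hb.symm.trans (Finset.sum_congr rfl fun n _ => ?_)⟩
  exact congrArg (_ • ·) (legSeq.basis_eq_self leg_isUnit n)

/-- The Legendre coefficients of `h` in terms of those of its weak derivative of order `k`. -/
lemma inner_polyW_of_weak {k : ℕ} (g : Lp ℝ 2 (jacobiMeasure k k))
    (hg : LocallyIntegrableOn g (Ioo (-1) 1)) (h : L2) {σ : ℝ}
    (H : ∀ φ : 𝓓(Lam, ℝ),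
      ∫ x, h x * iteratedDeriv k φ x ∂lamMeasure = σ * ∫ x, g x * φ x ∂lamMeasure) (n : ℕ) :
    σ * inner ℝ g (polyW k (derivative^[k] (leg n))) =
      (-1) ^ k * legLam n k * inner ℝ h (polyL2 (leg n)) := by
  have hgk := integrable_jacobiMeasure ((Lp.memLp g).integrable (by norm_num))
  have hh : Integrable h lamMeasure := (Lp.memLp h).integrable (by norm_num)
  have key := integral_weak_weight hh hg hgk H (derivative^[k] (leg n))
  rw [iterate_derivative_weight_mul] at key
  -- `key` is the weak identity tested on (1-x²)^k P_n^{(k)}, whose k-th derivative is a multiple of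
  -- P_n.
  rw [inner_polyLp, inner_polyLp, integral_jacobiMeasure, ← integral_const_mul]
  have e1 : ∀ x, h x * (C ((-1) ^ k * legLam n k) * leg n).eval x =
      (-1) ^ k * legLam n k * (h x * (leg n).eval x) := by
    intro x
    rw [eval_mul, eval_C]
    ring
  simp only [e1, integral_const_mul] at key
  rw [integral_const_mul, key]
  congr 1
  refine integral_congr_ae (ae_of_all _ fun x => ?_)
  simp
  ring

/-- The error of the `L²(Λ)` projection onto polynomials of degree less than `N`, in terms of a
weighted norm of the weak derivative of order `k`. -/
lemma norm_projection_error_le {k N : ℕ} (hN : 1 ≤ N) (hk : k ≤ N) {a : ℝ} (ha : a = k)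
    (g : Lp ℝ 2 (jacobiMeasure a a)) (hg : LocallyIntegrableOn g (Ioo (-1) 1)) (h e : L2) {σ : ℝ}
    (hσ : σ ^ 2 = 1)
    (H : ∀ φ : 𝓓(Lam, ℝ),
      ∫ x, h x * iteratedDeriv k φ x ∂lamMeasure = σ * ∫ x, g x * φ x ∂lamMeasure)
    (he0 : ∀ n < N, inner ℝ e (polyL2 (leg n)) = 0)
    (he : ∀ n, N ≤ n → inner ℝ e (polyL2 (leg n)) = inner ℝ h (polyL2 (leg n))) :
    ‖e‖ ≤ (k : ℝ) ^ k * ((N : ℝ) ^ k)⁻¹ * ‖g‖ := by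
  subst ha
  have hN0 : (0 : ℝ) < N := by exact_mod_cast hN
  refine norm_le_of_forall_polyL2 (by positivity) fun p => ?_
  obtain ⟨s, c, rfl⟩ := exists_leg_sum p
  set t := s.filter (N ≤ ·) with ht
  have htN : ∀ n ∈ t, N ≤ n := fun n hn => (Finset.mem_filter.1 hn).2
  -- Chosen so that (e, p) = ±(g, r): the terms n < N drop out, and for n ≥ N the coefficient of h
  -- is divided by λ_{n,k}.
  set r : Lp ℝ 2 (jacobiMeasure k k) :=
    ∑ n ∈ t, (c n / legLam n k) • polyW k (derivative^[k] (leg n)) with hr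
  have h1 : inner ℝ e (polyL2 (∑ n ∈ s, c n • leg n)) = σ * (-1) ^ k * inner ℝ g r := by
    simp only [map_sum, map_smul, inner_sum, hr, real_inner_smul_right, Finset.mul_sum]
    rw [← Finset.sum_filter_add_sum_filter_not s (N ≤ ·), ← ht]
    rw [Finset.sum_eq_zero (s := s.filter (¬ N ≤ ·)), add_zero]
    · refine Finset.sum_congr rfl fun n hn => ?_
      have key := inner_polyW_of_weak g hg h H n
      have hl := (legLam_pos (hk.trans (htN n hn))).ne'
      have h1 : ((-1 : ℝ) ^ k) * (-1) ^ k = 1 := by rw [← mul_pow]; simp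
      rw [he n (htN n hn)]
      field_simp
      linear_combination (-c n * (-1) ^ k) * key -
        c n * legLam n k * inner ℝ h (polyL2 (leg n)) * h1
    · intro n hn
      rw [he0 n (by simpa using (Finset.mem_filter.1 hn).2), mul_zero]
  have ho : ∀ i j, i ≠ j → inner ℝ (polyL2 (leg i)) (polyL2 (leg j)) = 0 :=
    fun i j => inner_leg_of_ne
  have h2 : ‖polyL2 (∑ n ∈ s, c n • leg n)‖ ^ 2 = ∑ n ∈ s, c n ^ 2 * ‖polyL2 (leg n)‖ ^ 2 := by
    simp only [map_sum, map_smul]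
    exact norm_sq_sum_of_orthogonal ho s c
  have h3 : ‖r‖ ^ 2 ≤ ((k : ℝ) ^ k * ((N : ℝ) ^ k)⁻¹) ^ 2 *
      ‖polyL2 (∑ n ∈ s, c n • leg n)‖ ^ 2 := by
    rw [hr, norm_sq_sum_of_orthogonal (fun i j hij => by
      rw [inner_polyW_derivative, ho i j hij, mul_zero]), h2, Finset.mul_sum]
    refine (Finset.sum_le_sum fun n hn => ?_).trans (Finset.sum_le_sum_of_subset_of_nonneg
      (Finset.filter_subset _ _) fun n _ _ => by positivity)
    have hl := legLam_pos (hk.trans (htN n hn))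
    rw [← real_inner_self_eq_norm_sq (polyW k _), inner_polyW_derivative,
      real_inner_self_eq_norm_sq]
    have hp := pow_le_legLam hk (htN n hn)
    -- The square root of k^k would suffice; k^k ≤ (k^k)² avoids it. For k = 0 the value is 0^0 = 1.
    have hk1 : (1 : ℝ) ≤ (k : ℝ) ^ k := by
      rcases Nat.eq_zero_or_pos k with h0 | h0
      · subst h0; simp
      · exact one_le_pow₀ (by exact_mod_cast h0)
    have h4 : 1 / legLam n k ≤ ((k : ℝ) ^ k * ((N : ℝ) ^ k)⁻¹) ^ 2 := by
      rw [mul_pow, inv_pow, ← pow_mul (N : ℝ), mul_comm k 2, ← div_eq_mul_inv,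
        div_le_div_iff₀ hl (by positivity), one_mul]
      refine hp.trans ?_
      gcongr
      nlinarith
    calc (c n / legLam n k) ^ 2 * (legLam n k * ‖polyL2 (leg n)‖ ^ 2)
        = 1 / legLam n k * (c n ^ 2 * ‖polyL2 (leg n)‖ ^ 2) := by field_simp
      _ ≤ _ := by gcongr
  have h5 : ‖r‖ ≤ (k : ℝ) ^ k * ((N : ℝ) ^ k)⁻¹ * ‖polyL2 (∑ n ∈ s, c n • leg n)‖ := by
    rw [← mul_pow] at h3
    exact le_of_sq_le_sq h3 (by positivity)
  have h6 : |σ * (-1) ^ k| = 1 := by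
    rw [abs_mul, abs_pow, abs_neg, abs_one, one_pow, mul_one]
    rw [← abs_one, ← sq_eq_sq_iff_abs_eq_abs, hσ, one_pow]
  rw [h1]
  calc σ * (-1) ^ k * inner ℝ g r ≤ |σ * (-1) ^ k * inner ℝ g r| := le_abs_self _
    _ = |inner ℝ g r| := by rw [abs_mul, h6, one_mul]
    _ ≤ ‖g‖ * ‖r‖ := abs_real_inner_le_norm _ _
    _ ≤ ‖g‖ * ((k : ℝ) ^ k * ((N : ℝ) ^ k)⁻¹ * ‖polyL2 (∑ n ∈ s, c n • leg n)‖) := by gcongr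
    _ = _ := by ring

/-! ### Fractional integrals -/

lemma integral_rpow_mul_sub_rpow {s r L : ℝ} (hs : 0 < s) (hr : 0 < r) (hL : 0 < L) :
    ∫ t in (0 : ℝ)..L, t ^ (s - 1) * (L - t) ^ (r - 1) =
      L ^ (s + r - 1) * (Real.Gamma s * Real.Gamma r / Real.Gamma (s + r)) := by
  have h := Complex.betaIntegral_scaled s r hL
  rw [Complex.betaIntegral_eq_Gamma_mul_div _ _ (by simpa using hs) (by simpa using hr)] at h
  have e : ∫ t in (0 : ℝ)..L, (t : ℂ) ^ ((s : ℂ) - 1) * ((L : ℂ) - t) ^ ((r : ℂ) - 1) =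
      ((∫ t in (0 : ℝ)..L, t ^ (s - 1) * (L - t) ^ (r - 1) : ℝ) : ℂ) := by
    rw [← intervalIntegral.integral_ofReal]
    refine intervalIntegral.integral_congr fun t ht => ?_
    rw [uIcc_of_le hL.le] at ht
    rw [Complex.ofReal_mul, Complex.ofReal_cpow ht.1, Complex.ofReal_cpow (by linarith [ht.2])]
    push_cast
    rfl
  rw [e] at h
  have e2 : (L : ℂ) ^ ((s : ℂ) + r - 1) = ((L ^ (s + r - 1) : ℝ) : ℂ) := by
    rw [Complex.ofReal_cpow hL.le]
    push_cast
    rfl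
  rw [e2, Complex.Gamma_ofReal, Complex.Gamma_ofReal, ← Complex.ofReal_add,
    Complex.Gamma_ofReal] at h
  exact_mod_cast h

lemma div_rpow_one_sub {y μ : ℝ} (hy : 0 ≤ y) (c : ℝ) : c / y ^ (1 - μ) = c * y ^ (μ - 1) := by
  rw [div_eq_mul_inv, ← Real.rpow_neg hy, neg_sub]

lemma fracInt_rpow {μ r x : ℝ} (hμ : 0 < μ) (hr : 0 < r) (hx : x < 1) :
    fracInt μ (fun y => (1 - y) ^ (r - 1)) x =
      Real.Gamma r / Real.Gamma (μ + r) * (1 - x) ^ (μ + r - 1) := by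
  have h := integral_rpow_mul_sub_rpow hμ hr (sub_pos.2 hx)
  have e : ∫ y in x..1, (1 - y) ^ (r - 1) / (y - x) ^ (1 - μ) =
      ∫ t in (0 : ℝ)..(1 - x), t ^ (μ - 1) * (1 - x - t) ^ (r - 1) := by
    have := intervalIntegral.integral_comp_sub_right (a := x) (b := 1)
      (fun t => t ^ (μ - 1) * (1 - x - t) ^ (r - 1)) x
    rw [sub_self] at this
    rw [← this]
    refine intervalIntegral.integral_congr fun y hy => ?_
    rw [uIcc_of_le hx.le] at hy
    rw [div_rpow_one_sub (by linarith [hy.1]), mul_comm, show 1 - x - (y - x) = 1 - y by ring]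
  rw [fracInt, e, h]
  have := (Real.Gamma_pos_of_pos hμ).ne'
  field_simp

lemma intervalIntegrable_frac {μ : ℝ} (hμ : 0 < μ) {w : ℝ → ℝ} (hw : Continuous w) {x : ℝ}
    (hx : x ≤ 1) : IntervalIntegrable (fun y => w y / (y - x) ^ (1 - μ)) volume x 1 := by
  have h1 : IntervalIntegrable (fun y : ℝ => (y - x) ^ (μ - 1)) volume x 1 := by
    have := (intervalIntegral.intervalIntegrable_rpow' (a := 0) (b := 1 - x) (r := μ - 1)
      (by linarith)).comp_sub_right x
    simpa using this
  refine (h1.continuousOn_mul hw.continuousOn).congr ?_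
  intro y hy
  rw [uIoc_of_le hx] at hy
  exact (div_rpow_one_sub (by linarith [hy.1]) _).symm

lemma fracInt_sum {μ : ℝ} (hμ : 0 < μ) {ι : Type*} (s : Finset ι) (a : ι → ℝ) {w : ι → ℝ → ℝ}
    (hw : ∀ i ∈ s, Continuous (w i)) {x : ℝ} (hx : x ≤ 1) :
    fracInt μ (∑ i ∈ s, a i • w i) x = ∑ i ∈ s, a i * fracInt μ (w i) x := by
  simp only [fracInt, Finset.sum_apply, Pi.smul_apply, smul_eq_mul, Finset.sum_div, mul_div_assoc]
  rw [intervalIntegral.integral_finsetSum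
    (fun i hi => (intervalIntegrable_frac hμ (hw i hi) hx).const_mul (a i)), Finset.mul_sum]
  refine Finset.sum_congr rfl fun i _ => ?_
  rw [intervalIntegral.integral_const_mul]
  ring

/-- For u merely integrable the integrand may fail to be integrable at some x. It is a convolution
integrand of two L¹ functions, the kernel being (-z)^{μ-1} on (-2,0), so it is integrable for almost
every x. This is what `fracInt_sub_ae` needs. -/
lemma ae_intervalIntegrable_frac {μ : ℝ} (hμ : 0 < μ) {u : ℝ → ℝ}
    (hu : IntegrableOn u (Ioo (-1) 1)) :
    ∀ᵐ x ∂lamMeasure, IntervalIntegrable (fun y => u y / (y - x) ^ (1 - μ)) volume x 1 := by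
  have hf : Integrable (indicator (Ioo (-1 : ℝ) 1) u) := by
    rwa [integrable_indicator_iff measurableSet_Ioo]
  have hK : Integrable (indicator (Ioo (-2 : ℝ) 0) fun z => (-z) ^ (μ - 1)) := by
    rw [integrable_indicator_iff measurableSet_Ioo]
    have := (intervalIntegral.intervalIntegrable_rpow' (a := 0) (b := 2) (r := μ - 1)
      (by linarith)).comp_sub_left 0
    simp only [zero_sub, sub_zero] at this
    rw [intervalIntegrable_iff, uIoc_of_ge (by norm_num)] at this
    exact this.mono_set (by simpa using Ioo_subset_Ioc_self)
  have h := hf.ae_convolution_exists (ContinuousLinearMap.mul ℝ ℝ) hK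
  filter_upwards [ae_restrict_of_ae (s := Ioo (-1 : ℝ) 1) h, ae_mem_Ioo] with x hx hxI
  rw [intervalIntegrable_iff_integrableOn_Ioo_of_le hxI.2.le]
  have h2 : Integrable _ volume := hx
  refine (h2.integrableOn (s := Ioo x 1)).congr_fun ?_ measurableSet_Ioo
  intro y hy
  have m1 : y ∈ Ioo (-1 : ℝ) 1 := ⟨hxI.1.trans hy.1, hy.2⟩
  have m2 : x - y ∈ Ioo (-2 : ℝ) 0 := ⟨by linarith [hxI.1, hy.2], by linarith [hy.1]⟩
  simp only [ContinuousLinearMap.mul_apply', indicator_of_mem m1, indicator_of_mem m2]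
  rw [div_rpow_one_sub (by linarith [hy.1]), neg_sub]

lemma fracInt_sub_ae {μ : ℝ} (hμ : 0 < μ) {u w : ℝ → ℝ} (hu : IntegrableOn u (Ioo (-1) 1))
    (hw : Continuous w) :
    fracInt μ (u - w) =ᵐ[lamMeasure] fun x => fracInt μ u x - fracInt μ w x := by
  filter_upwards [ae_intervalIntegrable_frac hμ hu, ae_mem_Ioo] with x hx hxI
  simp only [fracInt, Pi.sub_apply, sub_div]
  rw [intervalIntegral.integral_sub hx (intervalIntegrable_frac hμ hw hxI.2.le), mul_sub]

/-! ### Fractional integrals of generalized Jacobi functions. -/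

/-- The polynomial `∫_x^1 P_n`. -/
def legInt (n : ℕ) : ℝ[X] :=
  ∑ j ∈ Finset.range (n + 1),
    C (jacobiCoeff 0 0 n j * (-1 / 2) ^ j / ((j : ℝ) + 1)) * (1 - X) ^ (j + 1)

lemma derivative_legInt (n : ℕ) : derivative (legInt n) = -leg n := by
  rw [legInt, leg, jacobiP, derivative_sum, ← Finset.sum_neg_distrib]
  refine Finset.sum_congr rfl fun j _ => ?_
  rw [derivative_C_mul, derivative_pow_succ, ← jacobiCoeff]
  have h1 : (X - 1 : ℝ[X]) = (-1) * (1 - X) := by ring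
  have h2 : C (1 / 2 : ℝ) * (-1) = C (-1 / 2) := by
    rw [← C_1, ← C_neg, ← C_mul]
    norm_num
  rw [h1, ← mul_assoc (C (1 / 2 : ℝ)), h2, mul_pow, ← C_pow, ← mul_assoc (C _) (C _), ← C_mul]
  have h3 : derivative (1 - X : ℝ[X]) = -1 := by simp
  rw [h3]
  have h4 : ((j : ℝ) + 1) ≠ 0 := by positivity
  have h5 : C (jacobiCoeff 0 0 n j * (-1 / 2) ^ j / ((j : ℝ) + 1)) * C ((j : ℝ) + 1) =
      C (jacobiCoeff 0 0 n j * (-1 / 2) ^ j) := by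
    rw [← C_mul, div_mul_cancel₀ _ h4]
  linear_combination (-(1 - X) ^ j) * h5

lemma legInt_eval_one (n : ℕ) : (legInt n).eval 1 = 0 := by
  simp [legInt, eval_finsetSum]

lemma legInt_eval (n : ℕ) (x : ℝ) : (legInt n).eval x = ∫ y in x..1, (leg n).eval y := by
  have h := intervalIntegral.integral_eq_sub_of_hasDerivAt (a := x) (b := 1)
    (fun y _ => (legInt n).hasDerivAt y) ((derivative (legInt n)).continuous.intervalIntegrable _ _)
  rw [derivative_legInt, legInt_eval_one] at h
  simp only [eval_neg, intervalIntegral.integral_neg] at h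
  linarith

lemma leg_zero : leg 0 = 1 := by simp [leg, jacobiP]

lemma legInt_eval_neg_one {n : ℕ} (hn : 1 ≤ n) : (legInt n).eval (-1) = 0 := by
  rw [legInt_eval]
  have := integral_leg_mul_leg_of_ne (n := n) (j := 0) (by omega)
  simpa [leg_zero] using this

lemma legInt_zero_eval_neg_one : (legInt 0).eval (-1) = 2 := by
  rw [legInt_eval, leg_zero]
  norm_num

lemma degree_legInt_le (n : ℕ) : (legInt n).degree ≤ (n + 1 : ℕ) := by
  rw [legInt]
  refine degree_le_of_natDegree_le (natDegree_sum_le_of_forall_le _ _ fun j hj => ?_)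
  refine (natDegree_C_mul_le _ _).trans (natDegree_pow_le.trans ?_)
  have h1 : (1 - X : ℝ[X]).natDegree ≤ 1 := by
    refine (natDegree_sub_le _ _).trans ?_
    simp
  have := Finset.mem_range.1 hj
  calc (j + 1) * (1 - X : ℝ[X]).natDegree ≤ (j + 1) * 1 := by gcongr
    _ ≤ n + 1 := by omega

lemma fracInt_one_leg (n : ℕ) :
    fracInt 1 (fun x => (leg n).eval x) = fun x => (legInt n).eval x := by
  ext x
  simp [fracInt, legInt_eval]

lemma Gamma_mul_ascPochhammer {a : ℝ} (ha : 0 < a) (k : ℕ) :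
    Real.Gamma a * (ascPochhammer ℝ k).eval a = Real.Gamma (a + k) := by
  induction k with
  | zero => simp
  | succ k ih =>
    have : a + k ≠ 0 := by positivity
    rw [ascPochhammer_succ_eval, ← mul_assoc, ih, Nat.cast_succ, ← add_assoc,
      Real.Gamma_add_one this, mul_comm]

lemma continuous_gjf {α : ℝ} (hα : 0 ≤ α) (β : ℝ) (n : ℕ) : Continuous (gjf α β n) :=
  ((continuous_const.sub continuous_id).rpow_const fun _ => Or.inr hα).mul
    (jacobiP α β n).continuous

/-- Γ(2-μ+j) times the rising factorial (2-μ+j)_{n-j} is Γ(n+2-μ), independent of j; the other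
rising factorial is the Legendre one since (1-μ) + (μ-1) = 0. -/
lemma jacobiCoeff_mul_Gamma {μ : ℝ} (hμ1 : μ < 1) {n j : ℕ} (hj : j ≤ n) :
    jacobiCoeff (1 - μ) (μ - 1) n j *
      (Real.Gamma (2 - μ + j) / Real.Gamma (μ + (2 - μ + j))) =
      Real.Gamma (n + 2 - μ) / n.factorial * (jacobiCoeff 0 0 n j / (j + 1)) := by
  have h1 := Gamma_mul_ascPochhammer (a := 2 - μ + j) (by
    have : (0 : ℝ) ≤ j := by positivity
    linarith) (n - j)
  have h2 : μ + (2 - μ + j) = ((j + 1 : ℕ) : ℝ) + 1 := by push_cast; ring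
  have h3 := ascPochhammer_eval_natCast_succ j (n - j)
  rw [Nat.add_sub_cancel' hj] at h3
  rw [h2, Real.Gamma_nat_eq_factorial, Nat.factorial_succ]
  have h4 : (2 - μ + j + ((n - j : ℕ) : ℝ)) = n + 2 - μ := by
    rw [Nat.cast_sub hj]
    ring
  rw [h4] at h1
  rw [jacobiCoeff, jacobiCoeff, ← h1]
  rw [show (n : ℝ) + (1 - μ) + (μ - 1) + 1 = n + 0 + 0 + 1 by ring,
    show (1 - μ) + (j : ℝ) + 1 = 2 - μ + j by ring, zero_add, h3]
  have f1 : (n.factorial : ℝ) ≠ 0 := by exact_mod_cast n.factorial_ne_zero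
  have f2 : (j.factorial : ℝ) ≠ 0 := by exact_mod_cast j.factorial_ne_zero
  have f3 : ((n - j).factorial : ℝ) ≠ 0 := by exact_mod_cast (n - j).factorial_ne_zero
  have f4 : ((j : ℝ) + 1) ≠ 0 := by positivity
  push_cast
  field_simp

/-- The fractional integral of order `μ` of a generalized Jacobi function. -/
lemma fracInt_gjf {μ : ℝ} (hμ0 : 0 < μ) (hμ1 : μ < 1) (n : ℕ) {x : ℝ} (hx : x < 1) :
    fracInt μ (gjf (1 - μ) (μ - 1) n) x =
      Real.Gamma (n + 2 - μ) / n.factorial * (legInt n).eval x := by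
  have e : fracInt μ (gjf (1 - μ) (μ - 1) n) x = fracInt μ (∑ j ∈ Finset.range (n + 1),
      (jacobiCoeff (1 - μ) (μ - 1) n j * (-1 / 2) ^ j) • fun y : ℝ =>
        (1 - y) ^ ((2 - μ + j) - 1)) x := by
    rw [fracInt, fracInt]
    congr 1
    refine intervalIntegral.integral_congr fun y hy => ?_
    rw [uIcc_of_le hx.le] at hy
    congr 1
    have hy0 : 0 ≤ 1 - y := by linarith [hy.2]
    simp only [Finset.sum_apply, Pi.smul_apply, smul_eq_mul, gjf, jacobiP, eval_finsetSum,
      Finset.mul_sum]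
    refine Finset.sum_congr rfl fun j _ => ?_
    rw [← jacobiCoeff, show 2 - μ + (j : ℝ) - 1 = (1 - μ) + j by ring,
      Real.rpow_add_of_nonneg hy0 (by linarith) (by positivity), Real.rpow_natCast]
    simp only [eval_mul, eval_C, eval_pow, eval_sub, eval_X, eval_one]
    have : (1 / 2 * (y - 1)) ^ j = (-1 / 2) ^ j * (1 - y) ^ j := by
      rw [← mul_pow]
      congr 1
      ring
    rw [this]
    ring
  rw [e, fracInt_sum hμ0 _ _ (fun j _ => ?_) hx.le, legInt, eval_finsetSum, Finset.mul_sum]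
  · refine Finset.sum_congr rfl fun j hj => ?_
    have hj0 : (0 : ℝ) ≤ j := by positivity
    rw [fracInt_rpow hμ0 (by linarith) hx]
    have h := jacobiCoeff_mul_Gamma hμ1 (Nat.lt_succ_iff.1 (Finset.mem_range.1 hj))
    have h2 : μ + (2 - μ + (j : ℝ)) - 1 = ((j + 1 : ℕ) : ℝ) := by push_cast; ring
    rw [h2, Real.rpow_natCast]
    simp only [eval_mul, eval_C, eval_pow, eval_sub, eval_X, eval_one]
    linear_combination ((-1 / 2) ^ j * (1 - x) ^ (j + 1)) * h
  · have hj0 : (0 : ℝ) ≤ j := by positivity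
    exact (continuous_const.sub continuous_id).rpow_const fun _ => Or.inr (by linarith)

/-! ### Fractional derivatives -/

lemma hasFracDeriv_iff {μ : ℝ} (hμ0 : 0 < μ) (hμ1 : μ < 1) {m : ℕ} (hm : 1 ≤ m) {s : ℝ}
    (hs : s = m - μ) {u g : ℝ → ℝ} :
    HasFracDeriv s u g ↔ IntegrableOn u (Ioo (-1) 1) ∧
      HasWeakDeriv m (fracInt μ u) fun x => (-1) ^ m * g x := by
  have h1 : ⌊s⌋₊ + 1 = m := by
    have hm' : (1 : ℝ) ≤ m := by exact_mod_cast hm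
    have : ⌊s⌋₊ = m - 1 := by
      rw [Nat.floor_eq_iff (by linarith), Nat.cast_sub hm, hs]
      constructor <;> push_cast <;> linarith
    omega
  rw [HasFracDeriv, h1, hs, sub_sub_cancel]

lemma hasFracDeriv_one_sub_iff {μ : ℝ} (hμ0 : 0 < μ) (hμ1 : μ < 1) {u g : ℝ → ℝ} :
    HasFracDeriv (1 - μ) u g ↔ IntegrableOn u (Ioo (-1) 1) ∧
      HasWeakDeriv 1 (fracInt μ u) fun x => -g x := by
  rw [hasFracDeriv_iff hμ0 hμ1 le_rfl (by simp)]
  simp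

lemma hasFracDeriv_unique {μ : ℝ} (hμ0 : 0 < μ) (hμ1 : μ < 1) {u : ℝ → ℝ} {d d' : L2}
    (h : HasFracDeriv (1 - μ) u d) (h' : HasFracDeriv (1 - μ) u d') : d = d' := by
  rw [hasFracDeriv_one_sub_iff hμ0 hμ1] at h h'
  refine Lp.ext ?_
  filter_upwards [h.2.unique h'.2] with x hx using neg_inj.1 hx

lemma integrableOn_of_continuous {w : ℝ → ℝ} (hw : Continuous w) :
    IntegrableOn w (Ioo (-1) 1) :=
  (hw.continuousOn.integrableOn_compact isCompact_Icc).mono_set Ioo_subset_Icc_self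

lemma hasFracDeriv_of_fracInt_eq_polynomial {μ : ℝ} (hμ0 : 0 < μ) (hμ1 : μ < 1) {w : ℝ → ℝ}
    (hw : Continuous w) {q : ℝ[X]} (h : ∀ x < 1, fracInt μ w x = q.eval x) :
    HasFracDeriv (1 - μ) w (polyL2 (-derivative q)) := by
  rw [hasFracDeriv_one_sub_iff hμ0 hμ1]
  refine ⟨integrableOn_of_continuous hw, (hasWeakDeriv_one_polynomial q).congr ?_ ?_⟩
  · filter_upwards [ae_mem_Ioo] with x hx using h x hx.2
  · filter_upwards [coeFn_polyLp lamMeasure Measure.AbsolutelyContinuous.rfl (-derivative q)]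
      with x hx
    rw [hx, eval_neg, neg_neg]

/-- The factor `Γ(n+2-μ)/n!` in `D_+^{1-μ} J_n = Γ(n+2-μ)/n! P_n`. -/
def gjfFactor (μ : ℝ) (n : ℕ) : ℝ := Real.Gamma (n + 2 - μ) / n.factorial

lemma gjfFactor_pos {μ : ℝ} (hμ1 : μ < 1) (n : ℕ) : 0 < gjfFactor μ n := by
  have h : (0 : ℝ) ≤ n := by positivity
  exact div_pos (Real.Gamma_pos_of_pos (by linarith)) (by exact_mod_cast n.factorial_pos)

/-- The fractional derivative of order `1-μ` of a combination of generalized Jacobi functions. -/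
lemma hasFracDeriv_sum_gjf {μ : ℝ} (hμ0 : 0 < μ) (hμ1 : μ < 1) {ι : Type*} (s : Finset ι)
    (a : ι → ℝ) (k : ι → ℕ) :
    HasFracDeriv (1 - μ) (∑ i ∈ s, a i • gjf (1 - μ) (μ - 1) (k i))
      (∑ i ∈ s, a i • gjfFactor μ (k i) • polyL2 (leg (k i)) : L2) := by
  have hc : ∀ i ∈ s, Continuous (gjf (1 - μ) (μ - 1) (k i)) := fun i _ =>
    continuous_gjf (by linarith) _ _
  have := hasFracDeriv_of_fracInt_eq_polynomial hμ0 hμ1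
    (w := ∑ i ∈ s, a i • gjf (1 - μ) (μ - 1) (k i))
    (q := ∑ i ∈ s, a i • gjfFactor μ (k i) • legInt (k i))
    (by simpa only [Finset.sum_fn] using
      continuous_finsetSum s fun i hi => (hc i hi).const_smul (a i))
    (fun x hx => by
      rw [fracInt_sum hμ0 s a hc hx.le, eval_finsetSum]
      refine Finset.sum_congr rfl fun i _ => ?_
      rw [fracInt_gjf hμ0 hμ1 _ hx, eval_smul, eval_smul, gjfFactor, smul_eq_mul, smul_eq_mul])
  convert this using 2
  simp only [derivative_legInt, map_sum, map_smul, smul_neg, Finset.sum_neg_distrib, neg_neg]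

lemma exists_sum_of_mem_degreeLT (S : Polynomial.Sequence ℝ) {N : ℕ} {p : ℝ[X]}
    (hp : p ∈ degreeLT ℝ N) : ∃ c : ℕ → ℝ, p = ∑ n ∈ Finset.range N, c n • S n := by
  rw [← S.span_degreeLT fun i _ => by simp [S.ne_zero],
    ← Finset.coe_Iio, Nat.Iio_eq_range, Submodule.mem_span_image_finset_iff_exists_fun'] at hp
  obtain ⟨c, hc⟩ := hp
  exact ⟨c, hc.symm⟩

/-! ### The trial space -/

/-- The sequence of the polynomials `P_n^{(1-μ,μ-1)}`. -/
def gjfSeq (μ : ℝ) : Polynomial.Sequence ℝ :=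
  ⟨jacobiP (1 - μ) (μ - 1), fun n => degree_jacobiP (by
    have h : (0 : ℝ) ≤ n := by positivity
    linarith)⟩

lemma gjf_mem_VN {μ : ℝ} (hμ0 : 0 < μ) (hμ1 : μ < 1) {N n : ℕ} (h1 : 1 ≤ n) (hn : n < N) :
    gjf (1 - μ) (μ - 1) n ∈ VN μ hμ0 hμ1 N := by
  refine ⟨⟨jacobiP (1 - μ) (μ - 1) n, ?_, rfl⟩, ?_⟩
  · rw [mem_degreeLT]
    have := (gjfSeq μ).degree_eq n
    change (jacobiP (1 - μ) (μ - 1) n).degree = n at this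
    rw [this]
    exact_mod_cast hn
  · rw [fracInt_gjf hμ0 hμ1 n (by norm_num), legInt_eval_neg_one h1, mul_zero]

lemma exists_sum_of_mem_VN {μ : ℝ} (hμ0 : 0 < μ) (hμ1 : μ < 1) {N : ℕ} (hN : 1 ≤ N) {w : ℝ → ℝ}
    (hw : w ∈ VN μ hμ0 hμ1 N) :
    ∃ a : Fin (N - 1) → ℝ, w = ∑ n, a n • gjf (1 - μ) (μ - 1) (n + 1) := by
  obtain ⟨⟨ψ, hψ, rfl⟩, h0⟩ := hw
  obtain ⟨c, hc⟩ := exists_sum_of_mem_degreeLT (gjfSeq μ) hψ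
  have e : (fun x => (1 - x) ^ (1 - μ) * ψ.eval x) =
      ∑ n ∈ Finset.range N, c n • gjf (1 - μ) (μ - 1) n := by
    ext x
    rw [hc, eval_finsetSum, Finset.mul_sum, Finset.sum_apply]
    refine Finset.sum_congr rfl fun n _ => ?_
    rw [eval_smul, Pi.smul_apply, gjf, smul_eq_mul, smul_eq_mul]
    change _ * (c n * (jacobiP (1 - μ) (μ - 1) n).eval x) = _
    ring
  rw [e] at h0 ⊢
  obtain ⟨M, rfl⟩ : ∃ M, N = M + 1 := ⟨N - 1, by omega⟩
  rw [fracInt_sum hμ0 _ _ (fun i _ => continuous_gjf (by linarith) _ _) (by norm_num),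
    Finset.sum_range_succ', Finset.sum_eq_zero, zero_add, fracInt_gjf hμ0 hμ1 0 (by norm_num),
    legInt_zero_eval_neg_one] at h0
  -- At -1 every `legInt n` with n ≥ 1 vanishes and `legInt 0` equals 2, so the boundary condition
  -- removes exactly `J_0`.
  · have hc0 : c 0 = 0 := by
      have := (gjfFactor_pos hμ1 0).ne'
      rw [gjfFactor] at this
      exact (mul_eq_zero.1 h0).resolve_right (mul_ne_zero this two_ne_zero)
    refine ⟨fun n => c (n + 1), ?_⟩
    rw [Finset.sum_range_succ', hc0, zero_smul, add_zero]
    exact (Fin.sum_univ_eq_sum_range (fun n => c (n + 1) • gjf (1 - μ) (μ - 1) (n + 1)) M).symm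
  · intro n _
    rw [fracInt_gjf hμ0 hμ1 _ (by norm_num), legInt_eval_neg_one (by omega), mul_zero, mul_zero]

lemma inner_sum_smul_leg {M : ℕ} (a : Fin M → ℝ) (j : Fin M) :
    inner ℝ (∑ n : Fin M, a n • polyL2 (leg (n + 1))) (polyL2 (leg (j + 1))) =
      a j * (2 / (2 * ((j : ℕ) + 1 : ℕ) + 1)) := by
  rw [sum_inner, Finset.sum_eq_single j]
  · rw [real_inner_smul_left, inner_leg_self]
  · intro i _ hij
    rw [real_inner_smul_left, inner_leg_of_ne, mul_zero]
    intro h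
    exact hij (Fin.ext (by omega))
  · simp

lemma eq_zero_of_sum_smul_leg {M : ℕ} {a : Fin M → ℝ}
    (h : ∑ n : Fin M, a n • polyL2 (leg (n + 1)) = 0) (j : Fin M) : a j = 0 := by
  have := inner_sum_smul_leg a j
  rw [h, inner_zero_left] at this
  have h2 : (2 : ℝ) / (2 * ((j : ℕ) + 1 : ℕ) + 1) ≠ 0 := by positivity
  exact (mul_eq_zero.1 this.symm).resolve_right h2

/-- The basis of `V_N` by generalized Jacobi functions. -/
def gjfBasis {μ : ℝ} (hμ0 : 0 < μ) (hμ1 : μ < 1) {N : ℕ} (hN : 1 ≤ N) :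
    Module.Basis (Fin (N - 1)) ℝ (VN μ hμ0 hμ1 N) := by
  refine Module.Basis.mk (v := fun n => (⟨gjf (1 - μ) (μ - 1) (n + 1),
    gjf_mem_VN hμ0 hμ1 (by omega) (by omega)⟩ : VN μ hμ0 hμ1 N)) ?_ ?_
  · rw [Fintype.linearIndependent_iff]
    intro a ha j
    have h1 := congrArg Subtype.val ha
    rw [Submodule.coe_sum] at h1
    simp only [Submodule.coe_smul, ZeroMemClass.coe_zero] at h1
    have h2 := hasFracDeriv_sum_gjf hμ0 hμ1 Finset.univ a fun n : Fin (N - 1) => (n : ℕ) + 1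
    -- The empty sum gives the fractional derivative of 0; by uniqueness the Legendre combination in
    -- `h2` vanishes, and orthogonality applies.
    have h3 := hasFracDeriv_sum_gjf hμ0 hμ1 (∅ : Finset (Fin (N - 1))) a fun n => (n : ℕ) + 1
    rw [h1] at h2
    rw [Finset.sum_empty, Finset.sum_empty] at h3
    have h4 := hasFracDeriv_unique hμ0 hμ1 h2 h3
    simp only [smul_smul] at h4
    have h5 := eq_zero_of_sum_smul_leg h4 j
    exact (mul_eq_zero.1 h5).resolve_right (gjfFactor_pos hμ1 _).ne'
  · rintro ⟨w, hw⟩ -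
    obtain ⟨a, ha⟩ := exists_sum_of_mem_VN hμ0 hμ1 hN hw
    have : (⟨w, hw⟩ : VN μ hμ0 hμ1 N) = ∑ n : Fin (N - 1), a n • ⟨gjf (1 - μ) (μ - 1) (n + 1),
        gjf_mem_VN hμ0 hμ1 (by omega) (by omega)⟩ := by
      apply Subtype.ext
      rw [Submodule.coe_sum]
      exact ha
    rw [this]
    exact Submodule.sum_mem _ fun n _ => Submodule.smul_mem _ _ (Submodule.subset_span ⟨n, rfl⟩)

lemma coe_gjfBasis {μ : ℝ} (hμ0 : 0 < μ) (hμ1 : μ < 1) {N : ℕ} (hN : 1 ≤ N) (n : Fin (N - 1)) :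
    (gjfBasis hμ0 hμ1 hN n : ℝ → ℝ) = gjf (1 - μ) (μ - 1) (n + 1) := by
  simp [gjfBasis]

/-! ### The test space -/

/-- The derivative `H¹₀(Λ) → L²(Λ)`. -/
def sndLin : H10 →ₗ[ℝ] L2 where
  toFun w := w.1.snd
  map_add' _ _ := rfl
  map_smul' _ _ := rfl

lemma H10_ext {w w' : H10} (h : w.1.fst = w'.1.fst) : w = w' := by
  have h1 : HasWeakDeriv 1 w.1.fst w.1.snd := w.2.1
  have h2 : HasWeakDeriv 1 w'.1.fst w'.1.snd := w'.2.1
  rw [h] at h1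
  have h3 : w.1.snd = w'.1.snd := Lp.ext (h1.unique h2)
  exact Subtype.ext (WithLp.ofLp_injective 2 (Prod.ext h h3))

/-- A polynomial that vanishes at `±1` as an element of `H¹₀(Λ)`. -/
def polyH10 (q : ℝ[X]) (h1 : q.eval (-1) = 0) (h2 : q.eval 1 = 0) : H10 :=
  ⟨WithLp.toLp 2 (polyL2 q, polyL2 (derivative q)),
    (hasWeakDeriv_one_polynomial q).congr (coeFn_polyLp _ _ _) (coeFn_polyLp _ _ _),
    fun x => q.eval x, q.continuous.continuousOn, h1, h2, coeFn_polyLp _ _ _⟩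

/-- The function `I_+^1 P_{n+1}` as an element of `H¹₀(Λ)`. -/
def legH10 (n : ℕ) : H10 :=
  polyH10 (legInt (n + 1)) (legInt_eval_neg_one (by omega)) (legInt_eval_one _)

lemma legH10_fst (n : ℕ) : (legH10 n).1.fst = polyL2 (legInt (n + 1)) := rfl

lemma legH10_snd (n : ℕ) : (legH10 n).1.snd = -polyL2 (leg (n + 1)) := by
  change polyL2 (derivative (legInt (n + 1))) = _
  rw [derivative_legInt, map_neg]

lemma legH10_mem_PN0 {N n : ℕ} (hn : n + 1 < N) : legH10 n ∈ PN0 N := by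
  refine ⟨legInt (n + 1), mem_degreeLE.2 ((degree_legInt_le _).trans ?_), coeFn_polyLp _ _ _⟩
  exact_mod_cast hn

lemma integral_snd_eq_zero (w : H10) : ∫ x, w.1.snd x ∂lamMeasure = 0 := by
  obtain ⟨h, c, hc, hc1, hc2, hwc⟩ := w.2
  exact integral_weakDeriv_eq_zero h ((Lp.memLp w.1.snd).integrable (by norm_num)) hc hc1 hc2 hwc

lemma eval_eq_zero_of_H10 {w : H10} {p : ℝ[X]} (hp : w.1.fst =ᵐ[lamMeasure] fun x => p.eval x) :
    p.eval (-1) = 0 ∧ p.eval 1 = 0 := by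
  obtain ⟨h, c, hc, hc1, hc2, hwc⟩ := w.2
  have h1 : c =ᵐ[volume.restrict (Icc (-1 : ℝ) 1)] fun x => p.eval x := by
    rw [← restrict_Ioo_eq_restrict_Icc]
    exact hwc.symm.trans hp
  have h2 := Measure.eqOn_Icc_of_ae_eq volume (by norm_num) h1 hc p.continuous.continuousOn
  exact ⟨by rw [← hc1]; exact (h2 (by simp)).symm, by rw [← hc2]; exact (h2 (by simp)).symm⟩

lemma exists_sum_of_mem_PN0 {N : ℕ} (hN : 1 ≤ N) {w : H10} (hw : w ∈ PN0 N) :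
    ∃ a : Fin (N - 1) → ℝ, w = ∑ n, a n • legH10 n := by
  obtain ⟨p, hp, hpw⟩ := hw
  obtain ⟨hp1, hp2⟩ := eval_eq_zero_of_H10 hpw
  have hd : derivative p ∈ degreeLT ℝ N := by
    rw [mem_degreeLT]
    rcases eq_or_ne p 0 with rfl | h0
    · simp
    · refine (degree_derivative_lt h0).trans_le (mem_degreeLE.1 hp)
  obtain ⟨c, hc⟩ := exists_sum_of_mem_degreeLT legSeq hd
  have hc' : derivative p = ∑ n ∈ Finset.range N, c n • leg n := hc
  obtain ⟨M, rfl⟩ : ∃ M, N = M + 1 := ⟨N - 1, by omega⟩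
  rw [Finset.sum_range_succ'] at hc'
  -- p is recovered from its derivative: p(1) = 0 fixes the constant of integration, and p(-1) = 0
  -- then forces c 0 = 0.
  have hz : derivative (p - (∑ n ∈ Finset.range M, (-c (n + 1)) • legInt (n + 1) +
      (-c 0) • legInt 0)) = 0 := by
    rw [derivative_sub, hc']
    simp only [derivative_add, derivative_sum, derivative_smul, derivative_legInt, neg_smul,
      smul_neg, neg_neg, derivative_neg]
    exact sub_self _
  have hz2 := derivative_eq_zero.1 hz
  have hz3 : p = ∑ n ∈ Finset.range M, (-c (n + 1)) • legInt (n + 1) + (-c 0) • legInt 0 := by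
    rw [← sub_eq_zero, eq_C_of_natDegree_eq_zero hz2, C_eq_zero]
    have h3 := congrArg (eval 1) (eq_C_of_natDegree_eq_zero hz2)
    rw [eval_C, eval_sub, hp2, eval_add, eval_finsetSum, Finset.sum_eq_zero (fun n _ => by
      rw [eval_smul, legInt_eval_one, smul_zero]), eval_smul, legInt_eval_one] at h3
    simpa using h3.symm
  have hc0 : c 0 = 0 := by
    have h3 := congrArg (eval (-1)) hz3
    rw [hp1, eval_add, eval_finsetSum, Finset.sum_eq_zero (fun n _ => by
      rw [eval_smul, legInt_eval_neg_one (by omega), smul_zero]), eval_smul,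
      legInt_zero_eval_neg_one] at h3
    simpa using h3
  refine ⟨fun n => -c (n + 1), H10_ext ?_⟩
  have h4 : w.1.fst = polyL2 p := Lp.ext (hpw.trans (coeFn_polyLp _ _ p).symm)
  have h5 : ((∑ n : Fin M, (-c (n + 1)) • legH10 n : H10) : WithLp 2 (L2 × L2)).fst =
      ∑ n : Fin M, (-c (n + 1)) • (legH10 n).1.fst := by
    let F : H10 →ₗ[ℝ] L2 := { toFun := fun w => w.1.fst, map_add' := fun _ _ => rfl,
                              map_smul' := fun _ _ => rfl }
    change F _ = ∑ n : Fin M, (-c (n + 1)) • F (legH10 n)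
    rw [map_sum]
    simp only [map_smul]
  refine h4.trans (Eq.trans ?_ h5.symm)
  rw [hz3, hc0, neg_zero, zero_smul, add_zero, map_sum, ← Fin.sum_univ_eq_sum_range
    (fun n => polyL2 ((-c (n + 1)) • legInt (n + 1)))]
  simp only [map_smul, legH10_fst]

/-- The basis of `𝒫_N^0` by the functions `I_+^1 P_j`. -/
def testBasis {N : ℕ} (hN : 1 ≤ N) : Module.Basis (Fin (N - 1)) ℝ (PN0 N) := by
  refine Module.Basis.mk (v := fun n => (⟨legH10 n, legH10_mem_PN0 (by omega)⟩ : PN0 N)) ?_ ?_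
  · rw [Fintype.linearIndependent_iff]
    intro a ha j
    have h1 := congrArg (sndLin ∘ₗ (PN0 N).subtype) ha
    simp only [map_sum, map_smul, map_zero] at h1
    have h2 : ∑ n : Fin (N - 1), (-a n) • polyL2 (leg (n + 1)) = 0 := by
      rw [← h1]
      refine Finset.sum_congr rfl fun n _ => ?_
      change _ = a n • (legH10 n).1.snd
      rw [legH10_snd, neg_smul, smul_neg]
    exact neg_eq_zero.1 (eq_zero_of_sum_smul_leg h2 j)
  · rintro ⟨w, hw⟩ -
    obtain ⟨a, ha⟩ := exists_sum_of_mem_PN0 hN hw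
    have : (⟨w, hw⟩ : PN0 N) = ∑ n : Fin (N - 1), a n • ⟨legH10 n, legH10_mem_PN0 (by omega)⟩ := by
      apply Subtype.ext
      rw [Submodule.coe_sum]
      exact ha
    rw [this]
    exact Submodule.sum_mem _ fun n _ => Submodule.smul_mem _ _ (Submodule.subset_span ⟨n, rfl⟩)

lemma coe_testBasis {N : ℕ} (hN : 1 ≤ N) (n : Fin (N - 1)) :
    (testBasis hN n : H10) = legH10 n := by
  simp [testBasis]

/-! ### The scheme -/

/-- The fractional derivative of the `n`-th basis function of `V_N`. -/
def gjfDeriv (μ : ℝ) (n : ℕ) : L2 := gjfFactor μ (n + 1) • polyL2 (leg (n + 1))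

lemma hasFracDeriv_sum_gjfBasis {μ : ℝ} (hμ0 : 0 < μ) (hμ1 : μ < 1) {N : ℕ} (hN : 1 ≤ N)
    (a : Fin (N - 1) → ℝ) :
    HasFracDeriv (1 - μ) (∑ n, a n • (gjfBasis hμ0 hμ1 hN n : ℝ → ℝ))
      (∑ n : Fin (N - 1), a n • gjfDeriv μ n : L2) := by
  simp only [coe_gjfBasis]
  exact hasFracDeriv_sum_gjf hμ0 hμ1 Finset.univ a fun n : Fin (N - 1) => (n : ℕ) + 1

lemma hasFracDeriv_gjfBasis {μ : ℝ} (hμ0 : 0 < μ) (hμ1 : μ < 1) {N : ℕ} (hN : 1 ≤ N)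
    (n : Fin (N - 1)) : HasFracDeriv (1 - μ) (gjfBasis hμ0 hμ1 hN n : ℝ → ℝ) (gjfDeriv μ n) := by
  have := hasFracDeriv_sum_gjf hμ0 hμ1 {n} (fun _ => 1) fun n : Fin (N - 1) => (n : ℕ) + 1
  simpa only [Finset.sum_singleton, one_smul, coe_gjfBasis, gjfDeriv] using this

lemma inner_gjfDeriv_testBasis (μ : ℝ) {N : ℕ} (hN : 1 ≤ N) :
    (Matrix.of fun j n : Fin (N - 1) => inner ℝ (gjfDeriv μ n) (testBasis hN j).1.1.snd) =
      Matrix.diagonal (fun n : Fin (N - 1) =>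
        -(Real.Gamma ((n + 1 : ℕ) + 2 - μ) / (n + 1 : ℕ).factorial *
          (2 / (2 * (n + 1 : ℕ) + 1)))) := by
  ext j n
  rw [Matrix.of_apply, coe_testBasis, legH10_snd, inner_neg_right, gjfDeriv, real_inner_smul_left,
    Matrix.diagonal_apply]
  split_ifs with h
  · subst h
    rw [inner_leg_self, gjfFactor]
  · rw [inner_leg_of_ne, mul_zero, neg_zero]
    intro h2
    exact h (Fin.ext (by omega))

/-- Uniqueness of the fractional derivative identifies the derivative in the scheme with the
explicit Legendre sum, and linearity reduces the test space to its basis. -/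
lemma isGJFSolution_iff {μ : ℝ} (hμ0 : 0 < μ) (hμ1 : μ < 1) {N : ℕ} (hN : 1 ≤ N) (f : HNeg)
    (a : Fin (N - 1) → ℝ) :
    IsGJFSolution μ hμ0 hμ1 N f (∑ n, a n • (gjfBasis hμ0 hμ1 hN n : ℝ → ℝ)) ↔
      (Matrix.of fun j n : Fin (N - 1) =>
        inner ℝ (gjfDeriv μ n) (testBasis hN j).1.1.snd).mulVec a =
        fun j => f (testBasis hN j) := by
  have hD := hasFracDeriv_sum_gjfBasis hμ0 hμ1 hN a
  have hsum : ∀ y : L2, inner ℝ (∑ n : Fin (N - 1), a n • gjfDeriv μ n) y =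
      ∑ n : Fin (N - 1), inner ℝ (gjfDeriv μ n) y * a n := by
    intro y
    rw [sum_inner]
    exact Finset.sum_congr rfl fun n _ => by rw [real_inner_smul_left, mul_comm]
  constructor
  · rintro ⟨-, d, hd, h⟩
    ext j
    rw [← h _ (testBasis hN j).2, hasFracDeriv_unique hμ0 hμ1 hd hD, hsum]
    rfl
  · intro h
    refine ⟨Submodule.sum_mem _ fun n _ => Submodule.smul_mem _ _ (gjfBasis hμ0 hμ1 hN n).2,
      _, hD, fun w hw => ?_⟩
    have hext : (innerₛₗ ℝ (∑ n : Fin (N - 1), a n • gjfDeriv μ n)) ∘ₗ sndLin ∘ₗ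
        (PN0 N).subtype = (f : H10 →ₗ[ℝ] ℝ) ∘ₗ (PN0 N).subtype := by
      refine (testBasis hN).ext fun j => ?_
      have hj := congrFun h j
      change inner ℝ _ (testBasis hN j).1.1.snd = f (testBasis hN j)
      rw [hsum, ← hj]
      rfl
    exact LinearMap.congr_fun hext ⟨w, hw⟩

lemma eq_sum_gjfBasis {μ : ℝ} (hμ0 : 0 < μ) (hμ1 : μ < 1) {N : ℕ} (hN : 1 ≤ N) {w : ℝ → ℝ}
    (hw : w ∈ VN μ hμ0 hμ1 N) :
    ∃ a : Fin (N - 1) → ℝ, w = ∑ n, a n • (gjfBasis hμ0 hμ1 hN n : ℝ → ℝ) := by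
  simp only [coe_gjfBasis]
  exact exists_sum_of_mem_VN hμ0 hμ1 hN hw

lemma existsUnique_isGJFSolution {μ : ℝ} (hμ0 : 0 < μ) (hμ1 : μ < 1) {N : ℕ} (hN : 1 ≤ N)
    (f : HNeg) : ∃! uN : ℝ → ℝ, IsGJFSolution μ hμ0 hμ1 N f uN := by
  set D : Fin (N - 1) → ℝ := fun n => -(Real.Gamma ((n + 1 : ℕ) + 2 - μ) / (n + 1 : ℕ).factorial *
          (2 / (2 * (n + 1 : ℕ) + 1))) with hDdef
  have hD : ∀ n, D n ≠ 0 := fun n => by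
    have h1 := gjfFactor_pos hμ1 (n + 1)
    rw [gjfFactor] at h1
    exact neg_ne_zero.2 (mul_ne_zero h1.ne' (by positivity))
  have key : ∀ a : Fin (N - 1) → ℝ,
      IsGJFSolution μ hμ0 hμ1 N f (∑ n, a n • (gjfBasis hμ0 hμ1 hN n : ℝ → ℝ)) ↔
        ∀ j, D j * a j = f (testBasis hN j) := by
    intro a
    rw [isGJFSolution_iff, inner_gjfDeriv_testBasis, funext_iff]
    simp only [Matrix.mulVec_diagonal, hDdef]
  refine ⟨∑ n, (f (testBasis hN n) / D n) • (gjfBasis hμ0 hμ1 hN n : ℝ → ℝ),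
    (key _).2 fun j => mul_div_cancel₀ _ (hD j), fun w hw => ?_⟩
  obtain ⟨a, rfl⟩ := eq_sum_gjfBasis hμ0 hμ1 hN hw.1
  refine Finset.sum_congr rfl fun n _ => ?_
  rw [← (key a).1 hw n, mul_div_cancel_left₀ _ (hD n)]

/-! ### The error estimate -/

lemma continuous_of_mem_VN {μ : ℝ} (hμ0 : 0 < μ) (hμ1 : μ < 1) {N : ℕ} {w : ℝ → ℝ}
    (hw : w ∈ VN μ hμ0 hμ1 N) : Continuous w := by
  obtain ⟨⟨ψ, -, rfl⟩, -⟩ := hw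
  exact ((continuous_const.sub continuous_id).rpow_const fun _ => Or.inr (by linarith)).mul
    ψ.continuous

lemma inner_eq_integral (f g : L2) : inner ℝ f g = ∫ x, f x * g x ∂lamMeasure := by
  rw [L2.inner_def]
  refine integral_congr_ae (ae_of_all _ fun x => ?_)
  simp [mul_comm]

/-- The error `D_+^{1-μ}(u-u_N)` is the error of the `L²(Λ)` projection of `D_+^{1-μ}u = -Dv` onto
the polynomials of degree less than `N`. -/
lemma exists_error {μ : ℝ} (hμ0 : 0 < μ) (hμ1 : μ < 1) {N : ℕ} (hN : 1 ≤ N) {f : HNeg}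
    {u uN : ℝ → ℝ} (hu : IntegrableOn u (Ioo (-1) 1)) {v : H10}
    (hv : v.1.fst =ᵐ[lamMeasure] fracInt μ u) (hvf : ∀ w : H10, -inner ℝ v.1.snd w.1.snd = f w)
    (huN : IsGJFSolution μ hμ0 hμ1 N f uN) :
    ∃ e : L2, HasFracDeriv (1 - μ) (u - uN) e ∧
      (∀ n < N, inner ℝ e (polyL2 (leg n)) = 0) ∧
      ∀ n, N ≤ n → inner ℝ e (polyL2 (leg n)) = inner ℝ (-v.1.snd) (polyL2 (leg n)) := by
  obtain ⟨hmem, d, hd, hdw⟩ := huN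
  have hcont := continuous_of_mem_VN hμ0 hμ1 hmem
  obtain ⟨a, ha⟩ := exists_sum_of_mem_VN hμ0 hμ1 hN hmem
  have hd2 := hasFracDeriv_sum_gjf hμ0 hμ1 Finset.univ a fun n : Fin (N - 1) => (n : ℕ) + 1
  rw [← ha] at hd2
  have hdeq := hasFracDeriv_unique hμ0 hμ1 hd hd2
  have hd0 : ∀ n, (∀ i : Fin (N - 1), (i : ℕ) + 1 ≠ n) → inner ℝ d (polyL2 (leg n)) = 0 := by
    intro n hn
    rw [hdeq, sum_inner]
    refine Finset.sum_eq_zero fun i _ => ?_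
    rw [real_inner_smul_left, real_inner_smul_left, inner_leg_of_ne (hn i), mul_zero, mul_zero]
  refine ⟨-v.1.snd - d, ?_, fun n hn => ?_, fun n hn => ?_⟩
  · rw [hasFracDeriv_one_sub_iff hμ0 hμ1] at hd ⊢
    refine ⟨hu.sub hd.1, ?_⟩
    have hv1 : HasWeakDeriv 1 v.1.fst v.1.snd := v.2.1
    refine (hv1.add (hd.2.smul (-1))).congr ?_ ?_
    · filter_upwards [fracInt_sub_ae hμ0 hu hcont, hv] with x h1 h2
      rw [h1, h2]
      ring
    · filter_upwards [Lp.coeFn_sub (-v.1.snd) d, Lp.coeFn_neg v.1.snd] with x h1 h2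
      rw [h1, Pi.sub_apply, h2, Pi.neg_apply]
      ring
  · rw [inner_sub_left, inner_neg_left]
    rcases Nat.eq_zero_or_pos n with rfl | hn0
    -- No test function has derivative P_0. Here both terms vanish separately: the trial basis
    -- starts at `J_1`, and Dv has mean zero.
    · rw [hd0 0 fun i => by omega, inner_polyLp, leg_zero]
      simp [integral_snd_eq_zero]
    · have h1 := hdw (legH10 (n - 1)) (legH10_mem_PN0 (by omega))
      have h2 := hvf (legH10 (n - 1))
      rw [legH10_snd, Nat.sub_add_cancel hn0, inner_neg_right] at h1 h2
      linarith
  · rw [inner_sub_left, hd0 n fun i => by omega, sub_zero]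

/-! ### The two forms of the data as weak derivatives of -Dv. -/

/-- The `k`-th derivative of a test function as a test function. -/
def iteratedDerivTest (k : ℕ) (φ : 𝓓(Lam, ℝ)) : 𝓓(Lam, ℝ) := by
  have hsup : tsupport (iteratedDeriv k φ) ⊆ tsupport φ := by
    refine closure_minimal (fun x hx => support_iteratedFDeriv_subset (𝕜 := ℝ) (f := φ) k ?_)
      (isClosed_tsupport _)
    intro h0
    exact hx (by simp [iteratedDeriv_eq_iteratedFDeriv, h0])
  refine ⟨iteratedDeriv k φ, ?_, φ.hasCompactSupport.of_isClosed_subset (isClosed_tsupport _) hsup,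
    hsup.trans φ.tsupport_subset⟩
  rw [iteratedDeriv_eq_iterate]
  exact ContDiff.iterate_deriv k φ.contDiff

lemma integral_neg_coeFn_mul (f : L2) (w : ℝ → ℝ) :
    ∫ x, (-f : L2) x * w x ∂lamMeasure = -∫ x, f x * w x ∂lamMeasure := by
  rw [← integral_neg]
  refine integral_congr_ae ?_
  filter_upwards [Lp.coeFn_neg f] with x hx
  rw [hx, Pi.neg_apply, neg_mul]

/-- Testing Dv on φ^{(k)} is testing v on φ^{(k+1)}. The sign in the fractional derivative cancels
that of the weak derivative, so σ = 1 in `norm_projection_error_le`. -/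
lemma integral_neg_snd_of_hasFracDeriv {μ : ℝ} (hμ0 : 0 < μ) (hμ1 : μ < 1) {k : ℕ} {s : ℝ}
    (hs : s = (k + 1 : ℕ) - μ) {u g : ℝ → ℝ} {v : H10}
    (hv : v.1.fst =ᵐ[lamMeasure] fracInt μ u) (hg : HasFracDeriv s u g) :
    LocallyIntegrableOn g (Ioo (-1) 1) ∧ ∀ φ : 𝓓(Lam, ℝ),
      ∫ x, (-v.1.snd : L2) x * iteratedDeriv k φ x ∂lamMeasure =
        1 * ∫ x, g x * φ x ∂lamMeasure := by
  rw [hasFracDeriv_iff hμ0 hμ1 (by omega) hs] at hg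
  have hsq : ((-1 : ℝ) ^ (k + 1)) * (-1) ^ (k + 1) = 1 := by rw [← mul_pow]; simp
  constructor
  · have h := hg.2.2.1.smul ((-1 : ℝ) ^ (k + 1))
    have e : ((-1 : ℝ) ^ (k + 1) • fun x => (-1) ^ (k + 1) * g x) = g := by
      ext x
      rw [Pi.smul_apply, smul_eq_mul, ← mul_assoc, hsq, one_mul]
    rwa [e] at h
  · intro φ
    have hv1 : HasWeakDeriv 1 v.1.fst v.1.snd := v.2.1
    have h1 := hv1.2.2 (iteratedDerivTest k φ)
    have h2 := hg.2.2.2 φ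
    have h3 : iteratedDeriv 1 (iteratedDerivTest k φ) = iteratedDeriv (k + 1) φ := by
      rw [iteratedDeriv_one, iteratedDeriv_succ]
      rfl
    rw [h3, integral_congr_ae (g := fun x => fracInt μ u x * iteratedDeriv (k + 1) φ x)
      (by filter_upwards [hv] with x hx; rw [hx]), h2] at h1
    simp only [mul_assoc, integral_const_mul] at h1
    rw [← mul_assoc, hsq] at h1
    rw [integral_neg_coeFn_mul, h1]
    simp only [pow_one, neg_mul, one_mul]
    rfl

/-- The weak form with w = φ^{(k)}, so Dw = φ^{(k+1)}. A derivative of f of order k thus counts as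
one of -Dv of order k+1, with σ = (-1)^k. -/
lemma integral_neg_snd_of_hasDistribDeriv {k : ℕ} {f : HNeg} {g : ℝ → ℝ} {v : H10}
    (hvf : ∀ w : H10, -inner ℝ v.1.snd w.1.snd = f w) (hg : HasDistribDeriv k f g)
    (φ : 𝓓(Lam, ℝ)) :
    ∫ x, (-v.1.snd : L2) x * iteratedDeriv (k + 1) φ x ∂lamMeasure =
      (-1) ^ k * ∫ x, g x * φ x ∂lamMeasure := by
  obtain ⟨w, hw, hfw⟩ := hg.2 φ
  have hw1 : HasWeakDeriv 1 w.1.fst w.1.snd := w.2.1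
  have hφ := (hasWeakDeriv_one_of_contDiff ((iteratedDerivTest k φ).contDiff.of_le
    (by exact_mod_cast le_top))).congr hw EventuallyEq.rfl
  have hs := hw1.unique hφ
  rw [integral_neg_coeFn_mul, ← hfw, ← hvf, inner_eq_integral]
  congr 1
  refine integral_congr_ae ?_
  filter_upwards [hs] with x hx
  rw [hx, iteratedDeriv_succ]
  rfl

end GJF

end

theorem theorem5p2 (μ : ℝ) (hμ0 : 0 < μ) (hμ1 : μ < 1) :
    -- The scheme is uniquely solvable, and its system in the GJF basis is diagonal.
    (∀ N : ℕ, 1 ≤ N →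
      (∀ f : HNeg, ∃! uN : ℝ → ℝ, IsGJFSolution μ hμ0 hμ1 N f uN) ∧
      ∃ (J : Module.Basis (Fin (N - 1)) ℝ (VN μ hμ0 hμ1 N))
        (W : Module.Basis (Fin (N - 1)) ℝ (PN0 N)) (d : Fin (N - 1) → L2),
        (∀ n, (J n : ℝ → ℝ) = gjf (1 - μ) (μ - 1) (n + 1)) ∧
        (∀ j, (W j).1.1.fst =ᵐ[lamMeasure]
          fracInt 1 fun x => (jacobiP 0 0 (j + 1)).eval x) ∧
        (∀ n, HasFracDeriv (1 - μ) (J n) (d n)) ∧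
        (Matrix.of fun j n => inner ℝ (d n) (W j).1.1.snd) =
          Matrix.diagonal (fun n : Fin (N - 1) =>
            -(Real.Gamma ((n + 1 : ℕ) + 2 - μ) / (n + 1 : ℕ).factorial *
              (2 / (2 * (n + 1 : ℕ) + 1)))) ∧
        ∀ (f : HNeg) (a : Fin (N - 1) → ℝ),
          IsGJFSolution μ hμ0 hμ1 N f (∑ n, a n • (J n : ℝ → ℝ)) ↔
            (Matrix.of fun j n => inner ℝ (d n) (W j).1.1.snd).mulVec a = fun j => f (W j)) ∧
    -- The error estimates.
    ∀ m : ℕ, 1 ≤ m → ∃ c : ℝ, 0 < c ∧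
      ∀ N : ℕ, 1 ≤ N → m ≤ N + 1 →
      ∀ (f : HNeg) (u uN : ℝ → ℝ),
        IsWeakSolution μ f u → IsGJFSolution μ hμ0 hμ1 N f uN →
        (∀ g : Lp ℝ 2 (jacobiMeasure (m - 1) (m - 1)), HasFracDeriv (m - μ) u g →
          ∃ e : L2, HasFracDeriv (1 - μ) (u - uN) e ∧
            ‖e‖ ≤ c * (N : ℝ) ^ (1 - m : ℤ) * ‖g‖) ∧
        (2 ≤ m → ∀ g : Lp ℝ 2 (jacobiMeasure (m - 1) (m - 1)), HasDistribDeriv (m - 2) f g →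
          ∃ e : L2, HasFracDeriv (1 - μ) (u - uN) e ∧
            ‖e‖ ≤ c * (N : ℝ) ^ (1 - m : ℤ) * ‖g‖) := by
  refine ⟨fun N hN => ⟨existsUnique_isGJFSolution hμ0 hμ1 hN, gjfBasis hμ0 hμ1 hN, testBasis hN,
    fun n => gjfDeriv μ n, coe_gjfBasis hμ0 hμ1 hN, fun j => ?_, hasFracDeriv_gjfBasis hμ0 hμ1 hN,
    inner_gjfDeriv_testBasis μ hN, isGJFSolution_iff hμ0 hμ1 hN⟩, fun m hm => ?_⟩
  · rw [coe_testBasis, fracInt_one_leg]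
    exact coeFn_polyLp _ _ _
  · obtain ⟨k, rfl⟩ : ∃ k, m = k + 1 := ⟨m - 1, by omega⟩
    -- The constant from `norm_projection_error_le` with k = m-1.
    refine ⟨(k : ℝ) ^ k, by rcases Nat.eq_zero_or_pos k with rfl | h <;> [simp; positivity], ?_⟩
    intro N hN hmN f u uN ⟨hu, v, hv, hvf⟩ huN
    obtain ⟨e, he, he0, he1⟩ := exists_error hμ0 hμ1 hN hu hv hvf huN
    have hk : k ≤ N := by omega
    have hexp : (N : ℝ) ^ (1 - ((k + 1 : ℕ) : ℤ)) = ((N : ℝ) ^ k)⁻¹ := by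
      rw [← zpow_natCast, ← zpow_neg]
      congr 1
      push_cast
      ring
    have ha : ((k + 1 : ℕ) : ℝ) - 1 = k := by push_cast; ring
    rw [hexp]
    refine ⟨fun g hg => ⟨e, he, ?_⟩, fun h2 g hg => ⟨e, he, ?_⟩⟩
    · obtain ⟨hgl, H⟩ := integral_neg_snd_of_hasFracDeriv hμ0 hμ1 rfl hv hg
      exact norm_projection_error_le hN hk ha g hgl (-v.1.snd) e (by norm_num) H he0 he1
    · obtain ⟨l, rfl⟩ : ∃ l, k = l + 1 := ⟨k - 1, by omega⟩
      have H := integral_neg_snd_of_hasDistribDeriv hvf (k := l) hg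
      exact norm_projection_error_le hN hk ha g hg.1 (-v.1.snd) e (by rw [← pow_mul]; simp) H
        he0 he1
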